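/- Let $E,A\in\mathbb R^{n\times n}$, $B\in\mathbb R^{n\times m}$, $C\in\mathbb R^{k\times n}$, and let ${}^*$ denote the transpose. We use the following notions for a pair $(E,A)$ of real square matrices of the same size $n$ (and analogously for any other size). - $(E,A)$, or the pencil $sE-A$, is *regular* if $sE-A$ is invertible for some $s\in\mathbb C$. - A *finite eigenvalue* of the pencil is a $\lambda\in\mathbb C$ such that $\lambda Ev=Av$ for some complex vector $v\neq0$. - A regular pair $(E,A)$ is *impulse-free* if $\operatorname{rank}\begin{bmatrix}E&0\\A&E\end{bmatrix}=n+\operatorname{rank}E$. - A regular pair $(E,A)$ is *finite dynamics stable* if in its decoupled form $WET=\begin{bmatrix}I&0\\0&N\end{bmatrix}$, $WAT=\begin{bmatrix}J&0\\0&I\end{bmatrix}$ (with $W,T$ invertible complex matrices and $N$ nilpotent; $J$ is unique up to similarity) all eigenvalues of $J$ have negative real part. - $(E,A,B)$ is *finite dynamics stabilizable* if there is $K\in\mathbb R^{m\times n}$ such that $(E,A-BK)$ is regular and finite dynamics stable. - A *stabilizing solution* of the generalized algebraic Riccati equation $$A^*X+X^*A-X^*BB^*X+C^*C=0,\qquad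 E^*X=X^*E$$ is a solution $X\in\mathbb R^{n\times n}$ (of both equations) for which $(E,A-BB^*X)$ is regular, impulse-free and finite dynamics stable. Let $(E,A)$ be regular. Then the generalized algebraic Riccati equation has a stabilizing solution if and only if $(E,A,B)$ is finite dynamics stabilizable and the matrix pencil $$\mathcal H(s)=\begin{bmatrix}-sE+A&-BB^*\\-C^*C&-sE^*-A^*\end{bmatrix},$$ that is, the pencil of the pair $\left(\begin{bmatrix}E&0\\0&E^*\end{bmatrix},\begin{bmatrix}A&-BB^*\\-C^*C&-A^*\end{bmatrix}\right)$ of size $2n$ up to an overall sign, is regular, impulse-free, and has no finite eigenvalues on the imaginary axis. -/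

import Mathlib

namespace DescriptorLQR

open Matrix

/-- The complexification of a real matrix. -/
noncomputable abbrev toC {ι κ : Type*} (M : Matrix ι κ ℝ) : Matrix ι κ ℂ :=
  M.map Complex.ofRealHom

section Pencils

variable {ι : Type*} [Fintype ι] [DecidableEq ι]

/-- The pair `(E, A)`, i.e. the pencil `sE - A`, is regular: `sE - A` is invertible for some
complex `s`. -/
def IsRegular (E A : Matrix ι ι ℝ) : Prop :=
  ∃ s : ℂ, IsUnit (s • toC E - toC A)

/-- `lam` is a finite eigenvalue of the pencil `sE - A`: there is `v ≠ 0` with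
`lam E v = A v`. -/
def IsFiniteEigenvalue (E A : Matrix ι ι ℝ) (lam : ℂ) : Prop :=
  ∃ v : ι → ℂ, v ≠ 0 ∧ (lam • toC E) *ᵥ v = toC A *ᵥ v

/-- The (regular) pair `(E, A)` is impulse-free:
`rank [[E, 0], [A, E]] = n + rank E`, where `n` is the size of the matrices. -/
def IsImpulseFree (E A : Matrix ι ι ℝ) : Prop :=
  (fromBlocks E 0 A E).rank = Fintype.card ι + E.rank

/-- `(E, A)` is equivalent to the decoupled pair `(diag(I, N), diag(J, I))` with `N` nilpotent:
`W E T = diag(I, N)` and `W A T = diag(J, I)` with invertible `W`, `T`. The index `e` identifies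
the `r + q` coordinates of the slow and the fast subsystem with those of `(E, A)`. No normal form
of `J` and `N` is prescribed (they may in particular be Jordan matrices); `J` is determined by
`(E, A)` up to similarity. -/
def IsDecoupledForm (E A : Matrix ι ι ℝ) {r q : ℕ} (e : Fin r ⊕ Fin q ≃ ι)
    (J : Matrix (Fin r) (Fin r) ℂ) (N : Matrix (Fin q) (Fin q) ℂ) : Prop :=
  IsNilpotent N ∧
    ∃ W T : Matrix ι ι ℂ, IsUnit W ∧ IsUnit T ∧
      W * toC E * T = reindex e e (fromBlocks 1 0 0 N) ∧
      W * toC A * T = reindex e e (fromBlocks J 0 0 1)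

/-- `(E, A)` is regular and finite dynamics stable: the matrix `J` of its slow subsystem has only
eigenvalues with negative real part. -/
def IsFiniteDynamicsStable (E A : Matrix ι ι ℝ) : Prop :=
  IsRegular E A ∧
    ∃ (r q : ℕ) (e : Fin r ⊕ Fin q ≃ ι)
      (J : Matrix (Fin r) (Fin r) ℂ) (N : Matrix (Fin q) (Fin q) ℂ),
      IsDecoupledForm E A e J N ∧ ∀ mu ∈ spectrum ℂ J, mu.re < 0

/-- `(E, A, B)` is finite dynamics stabilizable: some feedback `K` makes `(E, A - B K)`
(regular and) finite dynamics stable. -/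
def IsFiniteDynamicsStabilizable {κ : Type*} [Fintype κ]
    (E A : Matrix ι ι ℝ) (B : Matrix ι κ ℝ) : Prop :=
  ∃ K : Matrix κ ι ℝ, IsFiniteDynamicsStable E (A - B * K)

/-- `X` solves the generalized algebraic Riccati equation
`A* X + X* A - X* B B* X + C* C = 0`, `E* X = X* E`. -/
def IsGARESolution {κ o : Type*} [Fintype κ] [Fintype o]
    (E A : Matrix ι ι ℝ) (B : Matrix ι κ ℝ) (C : Matrix o ι ℝ) (X : Matrix ι ι ℝ) : Prop :=
  Aᵀ * X + Xᵀ * A - Xᵀ * B * Bᵀ * X + Cᵀ * C = 0 ∧ Eᵀ * X = Xᵀ * E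

/-- `X` is a stabilizing solution of the generalized algebraic Riccati equation: the closed-loop
pair `(E, A - B B* X)` is regular, impulse-free and finite dynamics stable. -/
def IsStabilizingSolution {κ o : Type*} [Fintype κ] [Fintype o]
    (E A : Matrix ι ι ℝ) (B : Matrix ι κ ℝ) (C : Matrix o ι ℝ) (X : Matrix ι ι ℝ) : Prop :=
  IsGARESolution E A B C X ∧
    IsRegular E (A - B * Bᵀ * X) ∧
    IsImpulseFree E (A - B * Bᵀ * X) ∧
    IsFiniteDynamicsStable E (A - B * Bᵀ * X)

/-- The leading coefficient `diag(E, E*)` of the Hamiltonian pencil. -/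
def hamE (E : Matrix ι ι ℝ) : Matrix (ι ⊕ ι) (ι ⊕ ι) ℝ :=
  fromBlocks E 0 0 Eᵀ

/-- The constant coefficient `[[A, -B B*], [-C* C, -A*]]` of the Hamiltonian pencil. -/
def hamA {κ o : Type*} [Fintype κ] [Fintype o]
    (A : Matrix ι ι ℝ) (B : Matrix ι κ ℝ) (C : Matrix o ι ℝ) : Matrix (ι ⊕ ι) (ι ⊕ ι) ℝ :=
  fromBlocks A (-(B * Bᵀ)) (-(Cᵀ * C)) (-Aᵀ)

/-- The Hamiltonian pencil `H(s) = [[-sE + A, -B B*], [-C* C, -sE* - A*]]` is the pencil of the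
pair `(hamE E, hamA A B C)`, written as `-(s hamE - hamA)`. -/
theorem hamiltonianPencil_eq {κ o : Type*} [Fintype κ] [Fintype o]
    (E A : Matrix ι ι ℝ) (B : Matrix ι κ ℝ) (C : Matrix o ι ℝ) (s : ℂ) :
    fromBlocks (-(s • toC E) + toC A) (-toC (B * Bᵀ)) (-toC (Cᵀ * C))
      (-(s • toC Eᵀ) - toC Aᵀ) = -(s • toC (hamE E) - toC (hamA A B C)) := by
  ext i j
  rcases i with i | i <;> rcases j with j | j <;> simp [hamE, hamA, -Matrix.map_mul] <;> try ring

end Pencils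

end DescriptorLQR

/-! Necessity. If `X` solves the equation, substituting `y = z + X x` makes the Hamiltonian pencil
block triangular; the constraint `E* X = X* E` takes care of the terms in `s`. The diagonal blocks
are governed by the closed-loop pair and its transpose (with `s` replaced by `-s`), so imaginary
eigenvalues and impulses are excluded. Regularity follows because 0 is not an eigenvalue, and `K =
B* X` is a stabilizing feedback.

Sufficiency. The rank normal form makes `E = diag(1, 0)`; no Weierstrass form of `(E, A)` is needed.
The constraint then leaves the lower block row of `X` free in its right-hand block, and also in its
left-hand one. Impulse-freeness of the Hamiltonian pencil says that the Hamiltonian matrix of the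
fast blocks `(A4, B2, C2)` is injective, and `exists_riccati_of_injective_ham` yields a fast Riccati
solution with invertible closed loop. Shifting the unknown (`RiccatiSolvable.of_shift`) by it makes
`A4` invertible and the fast weight zero; a second shift removes the mixed weights, and block
elimination decouples the slow part. What remains is an ordinary Riccati equation.

That equation is solved by `exists_stabilizing_riccati`: the stable subspace of the Hamiltonian
matrix is Lagrangian, and stabilizability makes it the graph of a symmetric `X`. To stay over the
reals, the subspace is taken as the kernel of the stable factor of the characteristic polynomial. -/

namespace DescriptorLQR

/-! ### Stable and antistable factors of real polynomials. -/

open Matrix Polynomial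
-- Up to a unit, `p` is linear or the real quadratic of a conjugate pair. Hence each irreducible
-- factor lies entirely on one side of the imaginary axis.
theorem re_eq_re_of_irreducible {p : ℝ[X]} (hp : Irreducible p) {z w : ℂ}
    (hz : aeval z p = 0) (hw : aeval w p = 0) : z.re = w.re := by
  have key : ∀ {z w : ℂ}, z.im ≠ 0 → aeval z p = 0 → aeval w p = 0 → z.re = w.re := by
    intro z w him hz hw
    obtain ⟨c, hc⟩ := p.quadratic_dvd_of_aeval_eq_zero_im_ne_zero hz him
    have hdeg : (X ^ 2 - C (2 * z.re) * X + C (‖z‖ ^ 2) : ℝ[X]).natDegree = 2 := by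
      compute_degree!
    have hcu : IsUnit c := (hp.isUnit_or_isUnit hc).resolve_left fun hu => by
      have := natDegree_eq_zero_of_isUnit hu
      omega
    have hcw : aeval w c ≠ 0 := (hcu.map (aeval w)).ne_zero
    rw [hc, map_mul, mul_eq_zero, or_iff_left hcw] at hw
    have hf : (w - z) * (w - starRingEnd ℂ z) = 0 := by
      have h1 : z + starRingEnd ℂ z = ((2 * z.re : ℝ) : ℂ) := Complex.add_conj z
      have h2 : z * starRingEnd ℂ z = ((‖z‖ ^ 2 : ℝ) : ℂ) := by
        rw [Complex.mul_conj, Complex.normSq_eq_norm_sq]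
      simp only [map_add, map_sub, map_mul, map_pow, aeval_X, aeval_C,
        Complex.coe_algebraMap] at hw
      push_cast at h1 h2 hw
      linear_combination hw - w * h1 + h2
    rcases mul_eq_zero.mp hf with h | h
    · rw [sub_eq_zero.mp h]
    · rw [sub_eq_zero.mp h, Complex.conj_re]
  by_cases hzi : z.im = 0
  · by_cases hwi : w.im = 0
    · have hz' : z = algebraMap ℝ ℂ z.re := Complex.ext (by simp) (by simp [hzi])
      have hroot : p.IsRoot z.re := by
        rw [hz', aeval_algebraMap_apply] at hz
        exact Complex.ofReal_eq_zero.mp hz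
      obtain ⟨c, hc⟩ := dvd_iff_isRoot.mpr hroot
      have hcu : IsUnit c := (hp.isUnit_or_isUnit hc).resolve_left (not_isUnit_X_sub_C _)
      have hcw : aeval w c ≠ 0 := (hcu.map (aeval w)).ne_zero
      rw [hc, map_mul, mul_eq_zero, or_iff_left hcw] at hw
      simp only [map_sub, aeval_X, aeval_C, Complex.coe_algebraMap, sub_eq_zero] at hw
      rw [hw, Complex.ofReal_re]
    · exact (key hwi hw hz).symm
  · exact key hzi hz hw

/-- A real polynomial without imaginary roots splits into a stable and an antistable factor. -/
theorem exists_stable_mul_antistable (p : ℝ[X]) (hp : p ≠ 0)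
    (him : ∀ z : ℂ, aeval z p = 0 → z.re ≠ 0) :
    ∃ f g : ℝ[X], p = f * g ∧ (∀ z : ℂ, aeval z f = 0 → z.re < 0) ∧
      ∀ z : ℂ, aeval z g = 0 → 0 < z.re := by
  induction p using WfDvdMonoid.induction_on_irreducible with
  | zero => exact absurd rfl hp
  | unit u hu =>
    exact ⟨u, 1, (mul_one u).symm, fun z hz => absurd hz (hu.map (aeval z)).ne_zero,
      fun z hz => absurd hz (by simp)⟩
  | mul a i ha hi ih =>
    obtain ⟨f, g, rfl, hf, hg⟩ := ih ha fun z hz => him z (by simp [hz])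
    by_cases h : ∃ z : ℂ, aeval z i = 0 ∧ z.re < 0
    · obtain ⟨z, hz, hz0⟩ := h
      refine ⟨i * f, g, by ring, fun w hw => ?_, hg⟩
      rw [map_mul, mul_eq_zero] at hw
      exact hw.elim (fun h => re_eq_re_of_irreducible hi hz h ▸ hz0) (hf w)
    · push Not at h
      refine ⟨f, i * g, by ring, hf, fun w hw => ?_⟩
      rw [map_mul, mul_eq_zero] at hw
      exact hw.elim (fun h' => lt_of_le_of_ne (h w h') (him w (by simp [h'])).symm) (hg w)

/-- The roots of `f` and of `f(-X)` lie in opposite open half-planes. -/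
theorem isCoprime_comp_neg_X {f : ℝ[X]}
    (hf : (∀ z : ℂ, aeval z f = 0 → z.re < 0) ∨ ∀ z : ℂ, aeval z f = 0 → 0 < z.re) :
    IsCoprime f (f.comp (-X)) := by
  rw [Polynomial.isCoprime_iff_aeval_ne_zero_of_isAlgClosed ℝ ℂ]
  intro z
  by_contra! h
  obtain ⟨h1, h2⟩ := h
  rw [aeval_comp, map_neg, aeval_X] at h2
  rcases hf with hf | hf
  · have := hf z h1; have := hf _ h2; simp at this; linarith
  · have := hf z h1; have := hf _ h2; simp at this; linarith

/-! ### Polynomials in intertwined matrices, and complexification. -/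

section Intertwining
variable {R ι κ : Type*} [CommRing R] [Fintype ι] [DecidableEq ι] [Fintype κ] [DecidableEq κ]

theorem aeval_mul_eq_mul_aeval {M : Matrix ι ι R} {P : Matrix ι κ R} {N : Matrix κ κ R}
    (h : M * P = P * N) (q : R[X]) : aeval M q * P = P * aeval N q := by
  induction q using Polynomial.induction_on' with
  | add p q hp hq => rw [map_add, map_add, Matrix.add_mul, Matrix.mul_add, hp, hq]
  | monomial k a =>
    have hk : M ^ k * P = P * N ^ k := by
      induction k with
      | zero => simp
      | succ k ih => rw [pow_succ, Matrix.mul_assoc, h, ← Matrix.mul_assoc, ih, pow_succ,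
          Matrix.mul_assoc]
    simp [aeval_monomial, ← Algebra.smul_def, hk]

theorem aeval_transpose_matrix (M : Matrix ι ι R) (q : R[X]) : aeval Mᵀ q = (aeval M q)ᵀ := by
  induction q using Polynomial.induction_on' with
  | add p q hp hq => simp [hp, hq]
  | monomial k a => simp [aeval_monomial, ← Algebra.smul_def, Matrix.transpose_pow]

theorem aeval_mulVec_of_eq_smul {M : Matrix ι ι R} {v : ι → R} {mu : R} (h : M *ᵥ v = mu • v)
    (q : R[X]) : aeval M q *ᵥ v = q.eval mu • v := by
  induction q using Polynomial.induction_on' with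
  | add p q hp hq => simp [hp, hq, add_mulVec, add_smul]
  | monomial k a =>
    have hk : M ^ k *ᵥ v = mu ^ k • v := by
      induction k with
      | zero => simp
      | succ k ih => rw [pow_succ, ← mulVec_mulVec, h, mulVec_smul, ih, smul_smul, pow_succ,
          mul_comm]
    simp [aeval_monomial, ← Algebra.smul_def, hk, smul_mulVec, smul_smul]

end Intertwining

theorem toC_aeval {ι : Type*} [Fintype ι] [DecidableEq ι] (M : Matrix ι ι ℝ) (q : ℝ[X]) :
    toC (aeval M q) = aeval (toC M) (q.map Complex.ofRealHom) := by
  induction q using Polynomial.induction_on' with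
  | add p q hp hq => simp [hp, hq, Matrix.map_add]
  | monomial k a =>
    have hk : toC (M ^ k) = toC M ^ k := map_pow Complex.ofRealHom.mapMatrix M k
    simp only [aeval_monomial, ← Algebra.smul_def, map_monomial, ← hk]
    ext i j
    simp

section Complexification
variable {ι κ : Type*}

theorem toC_mulVec_re [Fintype κ] (M : Matrix ι κ ℝ) (z : κ → ℂ) (i : ι) :
    ((toC M *ᵥ z) i).re = (M *ᵥ fun j => (z j).re) i := by
  simp [mulVec, dotProduct]

theorem toC_mulVec_im [Fintype κ] (M : Matrix ι κ ℝ) (z : κ → ℂ) (i : ι) :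
    ((toC M *ᵥ z) i).im = (M *ᵥ fun j => (z j).im) i := by
  simp [mulVec, dotProduct]

theorem toC_mulVec_eq_zero_iff [Fintype κ] (M : Matrix ι κ ℝ) (z : κ → ℂ) :
    toC M *ᵥ z = 0 ↔ (M *ᵥ fun j => (z j).re) = 0 ∧ (M *ᵥ fun j => (z j).im) = 0 := by
  simp only [funext_iff, Complex.ext_iff, toC_mulVec_re, toC_mulVec_im, Pi.zero_apply,
    Complex.zero_re, Complex.zero_im, forall_and]

theorem toC_mul [Fintype ι] {o : Type*} (M : Matrix o ι ℝ) (N : Matrix ι κ ℝ) :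
    toC (M * N) = toC M * toC N := Matrix.map_mul

theorem toC_neg (M : Matrix ι κ ℝ) : toC (-M) = -toC M := by ext; simp

theorem toC_zero : toC (0 : Matrix ι κ ℝ) = 0 := by ext; simp

theorem toC_one [DecidableEq ι] : toC (1 : Matrix ι ι ℝ) = 1 :=
  Matrix.map_one _ (map_zero _) (map_one _)

theorem toC_add (M N : Matrix ι κ ℝ) : toC (M + N) = toC M + toC N := by ext; simp

theorem toC_sub (M N : Matrix ι κ ℝ) : toC (M - N) = toC M - toC N := by ext; simp

theorem toC_fromBlocks {l m n o : Type*} (A : Matrix n l ℝ) (B : Matrix n m ℝ)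
    (C : Matrix o l ℝ) (D : Matrix o m ℝ) :
    toC (fromBlocks A B C D) = fromBlocks (toC A) (toC B) (toC C) (toC D) :=
  fromBlocks_map A B C D _

end Complexification

/-! ### Isotropy of spectral subspaces of a Hamiltonian matrix. -/

section Invariant
variable {ι : Type*} [Fintype ι] [DecidableEq ι]

theorem mem_ker_aeval_toLin (H : Matrix ι ι ℝ) (q : ℝ[X]) (u : ι → ℝ) :
    u ∈ LinearMap.ker (aeval (toLinAlgEquiv' H) q) ↔ aeval H q *ᵥ u = 0 := by
  rw [LinearMap.mem_ker, show aeval (toLinAlgEquiv' H) q = toLinAlgEquiv' (aeval H q) from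
    (Polynomial.aeval_algHom_apply toLinAlgEquiv'.toAlgHom H q)]
  simp

/-- By Bézout, `u = f(-H) u'` for some `u'`. Moving `f(-H)` across `J` turns it into `f(H)`, which
kills `v`. -/
theorem dotProduct_mulVec_eq_zero_of_isCoprime {H J : Matrix ι ι ℝ} (hHJ : Hᵀ * J = J * -H)
    {f : ℝ[X]} (hf : IsCoprime f (f.comp (-X))) {u v : ι → ℝ}
    (hu : aeval H f *ᵥ u = 0) (hv : aeval H f *ᵥ v = 0) : u ⬝ᵥ J *ᵥ v = 0 := by
  obtain ⟨a, b, hab⟩ := hf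
  have hcomp : aeval H (f.comp (-X)) = aeval (-H) f := by rw [aeval_comp]; simp
  have h1 : aeval (-H) f *ᵥ (aeval H b *ᵥ u) = u := by
    have h2 : (aeval H (a * f + b * f.comp (-X))) *ᵥ u = u := by rw [hab]; simp
    rwa [map_add, add_mulVec, map_mul, ← mulVec_mulVec, hu, mulVec_zero, zero_add, mul_comm,
      map_mul, ← mulVec_mulVec, hcomp] at h2
  have h3 : (-H)ᵀ * J = J * H := by rw [transpose_neg, Matrix.neg_mul, hHJ, Matrix.mul_neg, neg_neg]
  have h4 : (aeval (-H) f)ᵀ * J = J * aeval H f := by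
    rw [← aeval_transpose_matrix, aeval_mul_eq_mul_aeval h3]
  rw [← h1, dotProduct_comm, dotProduct_mulVec, ← mulVec_transpose, mulVec_mulVec, h4,
    ← mulVec_mulVec, hv, mulVec_zero, zero_dotProduct]

/-- An isotropic subspace has at most half the dimension of the ambient space. -/
theorem two_mul_finrank_le_of_isotropic {J : Matrix ι ι ℝ} (hJ : J.det ≠ 0)
    (V : Submodule ℝ (ι → ℝ)) (hV : ∀ u ∈ V, ∀ v ∈ V, u ⬝ᵥ J *ᵥ v = 0) :
    2 * Module.finrank ℝ V ≤ Fintype.card ι := by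
  -- Nondegeneracy gives the orthogonal complement of `V` the complementary dimension.
  have hle : V ≤ LinearMap.BilinForm.orthogonal (toBilin' J) V := by
    intro v hv
    rw [LinearMap.BilinForm.mem_orthogonal_iff]
    intro u hu
    rw [toBilin'_apply', hV u hu v hv]
  have h1 := Submodule.finrank_mono hle
  rw [LinearMap.BilinForm.finrank_orthogonal
    (LinearMap.BilinForm.nondegenerate_toBilin'_iff_det_ne_zero.mpr hJ)] at h1
  have h2 := Submodule.finrank_le V
  simp only [Module.finrank_fintype_fun_eq_card] at h1 h2
  omega

end Invariant

/-! ### The ordinary Riccati equation via the stable subspace. -/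

section CARE
variable {ι κ : Type*} [Fintype ι] [DecidableEq ι] [Fintype κ]

/-- The Hamiltonian matrix of a Riccati equation. -/
def hamMatrix (A R Q : Matrix ι ι ℝ) : Matrix (ι ⊕ ι) (ι ⊕ ι) ℝ := fromBlocks A (-R) (-Q) (-Aᵀ)

/-- The standard symplectic matrix. -/
def sympl (ι : Type*) [DecidableEq ι] : Matrix (ι ⊕ ι) (ι ⊕ ι) ℝ := fromBlocks 0 1 (-1) 0

theorem sympl_det_ne_zero : (sympl ι).det ≠ 0 := by
  have h : sympl ι * fromBlocks 0 (-1) 1 0 = 1 := by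
    simp [sympl, fromBlocks_multiply, fromBlocks_one]
  exact (isUnit_det_of_right_inverse h).ne_zero

theorem hamMatrix_transpose_mul_sympl {A R Q : Matrix ι ι ℝ} (hR : Rᵀ = R) (hQ : Qᵀ = Q) :
    (hamMatrix A R Q)ᵀ * sympl ι = sympl ι * -hamMatrix A R Q := by
  simp [hamMatrix, sympl, fromBlocks_multiply, fromBlocks_transpose, fromBlocks_neg, hR, hQ]

theorem elim_dotProduct_sympl (a b c d : ι → ℝ) :
    (Sum.elim a b) ⬝ᵥ sympl ι *ᵥ (Sum.elim c d) = a ⬝ᵥ d - b ⬝ᵥ c := by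
  simp [sympl, fromBlocks_mulVec, Matrix.neg_mulVec, sub_eq_add_neg]

/-- No nonzero vector `(0, y)` lies in the stable subspace of the Hamiltonian matrix of a
stabilizable system. -/
theorem eq_zero_of_elim_zero_mem_stable {A : Matrix ι ι ℝ} {B : Matrix ι κ ℝ} {Q : Matrix ι ι ℝ}
    (hQ : Qᵀ = Q)
    (hstab : ∀ mu : ℂ, 0 ≤ mu.re → ∀ y, toC Aᵀ *ᵥ y = mu • y → toC Bᵀ *ᵥ y = 0 → y = 0)
    {f : ℝ[X]} (hf : ∀ z : ℂ, aeval z f = 0 → z.re < 0) {y : ι → ℝ}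
    (hy : aeval (hamMatrix A (B * Bᵀ) Q) f *ᵥ Sum.elim 0 y = 0) : y = 0 := by
  set H := hamMatrix A (B * Bᵀ) Q with hH
  have hHJ : Hᵀ * sympl ι = sympl ι * -H := hamMatrix_transpose_mul_sympl (by simp) hQ
  have hreal : ∀ a : ι → ℝ, aeval H f *ᵥ Sum.elim 0 a = 0 → Bᵀ *ᵥ a = 0 := by
    intro a ha
    -- Both `(0, a)` and `H (0, a)` lie in the isotropic stable subspace; their symplectic product
    -- is `|Bᵀ a|²`.
    have h1 : aeval H f *ᵥ (H *ᵥ Sum.elim 0 a) = 0 := by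
      rw [mulVec_mulVec, aeval_mul_eq_mul_aeval rfl f, ← mulVec_mulVec, ha, mulVec_zero]
    have h2 := dotProduct_mulVec_eq_zero_of_isCoprime hHJ (isCoprime_comp_neg_X (.inl hf)) ha h1
    rw [hH, hamMatrix, fromBlocks_mulVec, elim_dotProduct_sympl] at h2
    simp only [Sum.elim_comp_inl, Sum.elim_comp_inr, mulVec_zero, zero_add, Matrix.neg_mulVec,
      dotProduct_neg, zero_dotProduct, neg_zero, zero_sub, neg_eq_zero, ← mulVec_mulVec] at h2
    rw [dotProduct_mulVec, ← mulVec_transpose] at h2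
    exact dotProduct_self_eq_zero.mp h2
  have hre : ∀ z : ι → ℂ, (fun j => ((Sum.elim (0 : ι → ℂ) z : ι ⊕ ι → ℂ) j).re)
      = Sum.elim (0 : ι → ℝ) fun j => (z j).re := fun z => by ext (j | j) <;> simp
  have him : ∀ z : ι → ℂ, (fun j => ((Sum.elim (0 : ι → ℂ) z : ι ⊕ ι → ℂ) j).im)
      = Sum.elim (0 : ι → ℝ) fun j => (z j).im := fun z => by ext (j | j) <;> simp
  -- The complexified space of such `y`. It is killed by `Bᵀ` and invariant under `-Aᵀ`, so if
  -- nonzero it contains an eigenvector contradicting the Hautus condition.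
  let W : Submodule ℂ (ι → ℂ) :=
    { carrier := {z | toC (aeval H f) *ᵥ Sum.elim (0 : ι → ℂ) z = 0}
      zero_mem' := by
        have : (Sum.elim (0 : ι → ℂ) (0 : ι → ℂ)) = 0 := by ext (j | j) <;> rfl
        simp [this]
      add_mem' := fun {a b} ha hb => by
        have : (Sum.elim (0 : ι → ℂ) (a + b)) =
              Sum.elim (0 : ι → ℂ) a + Sum.elim (0 : ι → ℂ) b := by
          ext (j | j) <;> simp
        simp only [Set.mem_ofPred_eq] at ha hb ⊢
        rw [this, mulVec_add, ha, hb, add_zero]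
      smul_mem' := fun c a ha => by
        have : (Sum.elim (0 : ι → ℂ) (c • a)) = c • Sum.elim (0 : ι → ℂ) a := by
          ext (j | j) <;> simp
        simp only [Set.mem_ofPred_eq] at ha ⊢
        rw [this, mulVec_smul, ha, smul_zero] }
  have hWB : ∀ z ∈ W, toC Bᵀ *ᵥ z = 0 := by
    intro z hz
    obtain ⟨h1, h2⟩ := (toC_mulVec_eq_zero_iff _ _).mp hz
    rw [hre] at h1
    rw [him] at h2
    exact (toC_mulVec_eq_zero_iff _ _).mpr ⟨hreal _ h1, hreal _ h2⟩
  have hHz : ∀ z ∈ W, toC H *ᵥ Sum.elim (0 : ι → ℂ) z = Sum.elim (0 : ι → ℂ) (-(toC Aᵀ *ᵥ z)) := by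
    intro z hz
    have h1 : toC (B * Bᵀ) *ᵥ z = 0 := by
      rw [toC_mul, ← mulVec_mulVec, hWB z hz, mulVec_zero]
    rw [hH, hamMatrix, toC_fromBlocks, fromBlocks_mulVec]
    simp only [Sum.elim_comp_inl, Sum.elim_comp_inr, mulVec_zero, zero_add, h1, toC_neg, neg_zero,
      Matrix.neg_mulVec]
  have hWA : ∀ z ∈ W, (-toC Aᵀ).mulVecLin z ∈ W := by
    intro z hz
    change toC (aeval H f) *ᵥ Sum.elim (0 : ι → ℂ) ((-toC Aᵀ) *ᵥ z) = 0
    rw [Matrix.neg_mulVec, ← hHz z hz, mulVec_mulVec, ← toC_mul, aeval_mul_eq_mul_aeval rfl f,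
      toC_mul, ← mulVec_mulVec,
      show toC (aeval H f) *ᵥ Sum.elim (0 : ι → ℂ) z = 0 from hz, mulVec_zero]
  have hbot : W = ⊥ := by
    by_contra hne
    have : Nontrivial W := (Submodule.nontrivial_iff_ne_bot).mpr hne
    obtain ⟨mu, hmu⟩ := Module.End.exists_eigenvalue ((-toC Aᵀ).mulVecLin.restrict hWA)
    obtain ⟨⟨z, hz⟩, hzv⟩ := hmu.exists_hasEigenvector
    have h1 : -(toC Aᵀ *ᵥ z) = mu • z := by
      have := congrArg Subtype.val hzv.apply_eq_smul
      rw [← Matrix.neg_mulVec]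
      exact this
    have hz0 : z ≠ 0 := fun h => hzv.2 (Subtype.ext h)
    have h2 : toC H *ᵥ Sum.elim (0 : ι → ℂ) z = mu • Sum.elim (0 : ι → ℂ) z := by
      rw [hHz z hz, h1]
      ext (j | j) <;> simp
    have h3 : toC (aeval H f) *ᵥ Sum.elim (0 : ι → ℂ) z = 0 := hz
    rw [toC_aeval, aeval_mulVec_of_eq_smul h2, smul_eq_zero] at h3
    have h4 : aeval mu f = 0 := by
      rcases h3 with h3 | h3
      · rw [aeval_def, ← eval_map]; exact h3
      · exact absurd (funext fun j => congrFun h3 (Sum.inr j)) hz0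
    -- As a root of `f`, `mu` is stable, so the eigenvalue `-mu` of `Aᵀ` is not.
    refine hz0 (hstab (-mu) ?_ z ?_ (hWB z hz))
    · have := hf mu h4
      simp only [Complex.neg_re]; linarith
    · rw [neg_smul, ← h1, neg_neg]
  have hmem : (fun j => (y j : ℂ)) ∈ W := by
    change _ *ᵥ _ = _
    rw [toC_mulVec_eq_zero_iff, hre, him]
    refine ⟨by simpa using hy, ?_⟩
    have : (Sum.elim (0 : ι → ℝ) fun j => ((y j : ℂ)).im : ι ⊕ ι → ℝ) = 0 := by ext (j | j) <;> simp
    rw [this, mulVec_zero]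
  rw [hbot, Submodule.mem_bot] at hmem
  ext j
  exact Complex.ofReal_eq_zero.mp (congrFun hmem j)

/-- Existence of the stabilizing solution of the Riccati equation of a stabilizable system whose
Hamiltonian matrix has no eigenvalues on the imaginary axis. -/
theorem exists_stabilizing_riccati (A : Matrix ι ι ℝ) (B : Matrix ι κ ℝ) (Q : Matrix ι ι ℝ)
    (hQ : Qᵀ = Q)
    (hstab : ∀ mu : ℂ, 0 ≤ mu.re → ∀ y, toC Aᵀ *ᵥ y = mu • y → toC Bᵀ *ᵥ y = 0 → y = 0)
    (him : ∀ mu : ℂ, mu.re = 0 → ∀ x y, toC A *ᵥ x - toC (B * Bᵀ) *ᵥ y = mu • x →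
      toC Q *ᵥ x + toC Aᵀ *ᵥ y = -(mu • y) → x = 0 ∧ y = 0) :
    ∃ X : Matrix ι ι ℝ, Xᵀ = X ∧ Aᵀ * X + X * A - X * (B * Bᵀ) * X + Q = 0 ∧
      ∀ mu ∈ spectrum ℂ (toC (A - B * Bᵀ * X)), mu.re < 0 := by
  set H := hamMatrix A (B * Bᵀ) Q with hH
  have hHJ : Hᵀ * sympl ι = sympl ι * -H := hamMatrix_transpose_mul_sympl (by simp) hQ
  obtain ⟨f, g, hfg, hf, hg⟩ := exists_stable_mul_antistable H.charpoly (charpoly_monic H).ne_zero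
    (by
      intro z hz hz0
      have h1 : (toC H).charpoly.IsRoot z := by
        rw [charpoly_map, IsRoot, eval_map]
        exact hz
      have h2 : ((toC H) - z • 1).det = 0 := by
        rw [IsRoot, eval_charpoly] at h1
        rw [show toC H - z • 1 = -(Matrix.scalar (ι ⊕ ι) z - toC H) by
          rw [neg_sub, Matrix.scalar_apply, Matrix.smul_one_eq_diagonal], det_neg, h1, mul_zero]
      obtain ⟨v, hv0, hv⟩ := exists_mulVec_eq_zero_iff.mpr h2
      rw [Matrix.sub_mulVec, smul_mulVec, one_mulVec, sub_eq_zero, hH, hamMatrix, toC_fromBlocks,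
        fromBlocks_mulVec] at hv
      have hv1 : toC A *ᵥ (v ∘ Sum.inl) + toC (-(B * Bᵀ)) *ᵥ (v ∘ Sum.inr) = z • (v ∘ Sum.inl) :=
        funext fun j => congrFun hv (Sum.inl j)
      have hv2 : toC (-Q) *ᵥ (v ∘ Sum.inl) + toC (-Aᵀ) *ᵥ (v ∘ Sum.inr) = z • (v ∘ Sum.inr) :=
        funext fun j => congrFun hv (Sum.inr j)
      rw [toC_neg, Matrix.neg_mulVec, ← sub_eq_add_neg] at hv1
      rw [toC_neg, toC_neg, Matrix.neg_mulVec, Matrix.neg_mulVec] at hv2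
      obtain ⟨h3, h4⟩ := him z hz0 _ _ hv1 (by rw [← hv2]; abel)
      refine hv0 (funext fun j => ?_)
      rcases j with j | j
      · exact congrFun h3 j
      · exact congrFun h4 j)
  set L := toLinAlgEquiv' H with hL
  set V := LinearMap.ker (aeval L f) with hV
  have hmemV : ∀ u, u ∈ V ↔ aeval H f *ᵥ u = 0 := mem_ker_aeval_toLin H f
  have hfcop := isCoprime_comp_neg_X (f := f) (.inl hf)
  have hgcop := isCoprime_comp_neg_X (f := g) (.inr hg)
  have hVle := two_mul_finrank_le_of_isotropic (sympl_det_ne_zero (ι := ι)) V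
    fun u hu v hv => dotProduct_mulVec_eq_zero_of_isCoprime hHJ hfcop
      ((hmemV u).mp hu) ((hmemV v).mp hv)
  have hVle' := two_mul_finrank_le_of_isotropic (sympl_det_ne_zero (ι := ι))
    (LinearMap.ker (aeval L g))
    fun u hu v hv => dotProduct_mulVec_eq_zero_of_isCoprime hHJ hgcop
      ((mem_ker_aeval_toLin H g u).mp hu) ((mem_ker_aeval_toLin H g v).mp hv)
  have hcop : IsCoprime f g := by
    rw [Polynomial.isCoprime_iff_aeval_ne_zero_of_isAlgClosed ℝ ℂ]
    intro z
    by_contra! h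
    exact absurd (hf z h.1) (not_lt.mpr (hg z h.2).le)
  have hsup : V ⊔ LinearMap.ker (aeval L g) = ⊤ := by
    rw [hV, Polynomial.sup_ker_aeval_eq_ker_aeval_mul_of_coprime L hcop, ← hfg, eq_top_iff]
    intro u _
    rw [hL, mem_ker_aeval_toLin, aeval_self_charpoly, zero_mulVec]
  -- The two kernels span a space of dimension `2n`, while isotropy bounds each by `n`.
  have hdim : Module.finrank ℝ V = Fintype.card ι := by
    have h1 := Submodule.finrank_add_le_finrank_add_finrank V (LinearMap.ker (aeval L g))
    rw [hsup, finrank_top] at h1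
    simp only [Module.finrank_fintype_fun_eq_card, Fintype.card_sum] at h1 hVle hVle'
    omega
  -- Bijectivity of the projection to the first component makes `V` the graph of a matrix `X`.
  let P1 : V →ₗ[ℝ] (ι → ℝ) := (LinearMap.funLeft ℝ ℝ (Sum.inl : ι → ι ⊕ ι)) ∘ₗ V.subtype
  have hinj : Function.Injective P1 := by
    rw [← LinearMap.ker_eq_bot, LinearMap.ker_eq_bot']
    rintro ⟨u, hu⟩ h0
    have h0' : u ∘ Sum.inl = 0 := h0
    have hu' : u = Sum.elim (0 : ι → ℝ) (u ∘ Sum.inr) := by rw [← h0', Sum.elim_comp_inl_inr]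
    have hz := (hmemV u).mp hu
    rw [hu'] at hz
    have := eq_zero_of_elim_zero_mem_stable hQ hstab hf hz
    refine Subtype.ext ?_
    change u = 0
    rw [hu', this]
    ext (j | j) <;> rfl
  let phi : V ≃ₗ[ℝ] (ι → ℝ) := LinearEquiv.ofInjectiveOfFinrankEq P1 hinj
    (by rw [hdim, Module.finrank_fintype_fun_eq_card])
  let X : Matrix ι ι ℝ := LinearMap.toMatrix'
    ((LinearMap.funLeft ℝ ℝ (Sum.inr : ι → ι ⊕ ι)) ∘ₗ V.subtype ∘ₗ phi.symm.toLinearMap)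
  have hXmem : ∀ x, Sum.elim x (X *ᵥ x) ∈ V := by
    intro x
    have h1 : X *ᵥ x = (phi.symm x : ι ⊕ ι → ℝ) ∘ Sum.inr := by
      rw [← toLin'_apply, toLin'_toMatrix']; rfl
    have h2 : x = (phi.symm x : ι ⊕ ι → ℝ) ∘ Sum.inl := (phi.apply_symm_apply x).symm
    have h3 : Sum.elim x (X *ᵥ x) = (phi.symm x : ι ⊕ ι → ℝ) := by
      rw [h1]
      nth_rewrite 1 [h2]
      exact Sum.elim_comp_inl_inr _
    rw [h3]
    exact (phi.symm x).2
  have hXuniq : ∀ x y, Sum.elim x y ∈ V → y = X *ᵥ x := by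
    intro x y h
    have h1 : (⟨_, h⟩ : V) = ⟨_, hXmem x⟩ := hinj rfl
    exact funext fun j => congrFun (congrArg Subtype.val h1) (Sum.inr j)
  -- A graph is isotropic for the symplectic form exactly when its matrix is symmetric.
  have hsymm : Xᵀ = X := by
    refine Matrix.ext_of_mulVec_single fun i => ?_
    refine dotProduct_eq _ _ fun w => ?_
    have h1 := dotProduct_mulVec_eq_zero_of_isCoprime hHJ hfcop
      ((hmemV _).mp (hXmem (Pi.single i 1))) ((hmemV _).mp (hXmem w))
    rw [elim_dotProduct_sympl, sub_eq_zero] at h1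
    rw [← h1, mulVec_transpose, ← dotProduct_mulVec]
  have hHV : ∀ x, H *ᵥ Sum.elim x (X *ᵥ x) =
      Sum.elim ((A - B * Bᵀ * X) *ᵥ x) ((-Q - Aᵀ * X) *ᵥ x) := by
    intro x
    rw [hH, hamMatrix, fromBlocks_mulVec]
    simp only [Sum.elim_comp_inl, Sum.elim_comp_inr, Matrix.neg_mulVec, Matrix.add_mulVec,
      ← mulVec_mulVec, sub_eq_add_neg]
  -- Invariance of the graph under `H` is the Riccati equation.
  have hinv : ∀ x, (-Q - Aᵀ * X) *ᵥ x = X *ᵥ ((A - B * Bᵀ * X) *ᵥ x) := by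
    intro x
    refine hXuniq _ _ ?_
    rw [← hHV, hmemV, mulVec_mulVec, aeval_mul_eq_mul_aeval rfl f, ← mulVec_mulVec,
      (hmemV _).mp (hXmem x), mulVec_zero]
  have hric : -Q - Aᵀ * X = X * (A - B * Bᵀ * X) :=
    Matrix.ext_of_mulVec_single fun i => by rw [hinv, mulVec_mulVec]
  refine ⟨X, hsymm, ?_, ?_⟩
  · rw [Matrix.mul_sub] at hric
    have : Aᵀ * X + X * A - X * (B * Bᵀ) * X + Q
      = X * A - X * (B * Bᵀ * X) - (-Q - Aᵀ * X) := by rw [Matrix.mul_assoc X]; abel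
    rw [this, ← hric, sub_self]
  · set G := A - B * Bᵀ * X with hG
    set P : Matrix (ι ⊕ ι) ι ℝ := fromRows 1 X with hP
    have hPx : ∀ x, P *ᵥ x = Sum.elim x (X *ᵥ x) := fun x => by
      rw [hP, fromRows_mulVec, one_mulVec]
    have hHP : H * P = P * G := Matrix.ext_of_mulVec_single fun i => by
      rw [← mulVec_mulVec, ← mulVec_mulVec, hPx, hPx, hHV, hinv]
    -- `G` represents `H` restricted to the graph, so the stable polynomial `f` annihilates it.
    have hfG : aeval G f = 0 := by
      refine Matrix.ext_of_mulVec_single fun i => ?_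
      have h1 : P *ᵥ (aeval G f *ᵥ Pi.single i 1) = 0 := by
        rw [mulVec_mulVec, ← aeval_mul_eq_mul_aeval hHP, ← mulVec_mulVec, hPx]
        exact (hmemV _).mp (hXmem _)
      rw [hPx] at h1
      rw [zero_mulVec]
      exact funext fun j => congrFun h1 (Sum.inl j)
    intro mu hmu
    rw [← spectrum_toLin', ← Module.End.hasEigenvalue_iff_mem_spectrum] at hmu
    obtain ⟨v, hv⟩ := hmu.exists_hasEigenvector
    have h1 : toC G *ᵥ v = mu • v := hv.apply_eq_smul
    have h2 := aeval_mulVec_of_eq_smul h1 (f.map Complex.ofRealHom)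
    rw [← toC_aeval, hfG, toC_zero, zero_mulVec, eq_comm,
      smul_eq_zero, or_iff_left hv.2] at h2
    refine hf mu ?_
    rw [aeval_def, ← eval_map]
    exact h2

end CARE

end DescriptorLQR

namespace DescriptorLQR

open Matrix

set_option linter.unusedSectionVars false

/-! ### Changes of coordinates and shifts of the unknown. -/

section Reduction
variable {ι σ κ : Type*} [Fintype ι] [DecidableEq ι] [Fintype σ] [DecidableEq σ] [Fintype κ]

/-- The Hautus form of finite dynamics stabilizability. -/
def HautusStabilizable (E A : Matrix ι ι ℝ) (B : Matrix ι κ ℝ) : Prop :=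
  ∀ mu : ℂ, 0 ≤ mu.re → ∀ y, toC Aᵀ *ᵥ y = mu • (toC Eᵀ *ᵥ y) → toC Bᵀ *ᵥ y = 0 → y = 0

/-- The Hamiltonian pencil has no finite eigenvalues on the imaginary axis. -/
def NoImaginaryEigenvalue (E A R Q : Matrix ι ι ℝ) : Prop :=
  ∀ mu : ℂ, mu.re = 0 → ∀ x y, toC A *ᵥ x - toC R *ᵥ y = mu • (toC E *ᵥ x) →
    toC Q *ᵥ x + toC Aᵀ *ᵥ y = -(mu • (toC Eᵀ *ᵥ y)) → x = 0 ∧ y = 0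

/-- The left-hand side of the Riccati equation. -/
def riccati (A R Q X : Matrix ι ι ℝ) : Matrix ι ι ℝ := Aᵀ * X + Xᵀ * A - Xᵀ * R * X + Q

/-- `(E, G)` is really equivalent to `(diag(1, 0), diag(J, 1))` with stable `J`. -/
def HasStableForm (E G : Matrix ι ι ℝ) : Prop :=
  ∃ (r q : ℕ) (W : Matrix (Fin r ⊕ Fin q) ι ℝ) (Wi : Matrix ι (Fin r ⊕ Fin q) ℝ)
    (T : Matrix ι (Fin r ⊕ Fin q) ℝ) (Ti : Matrix (Fin r ⊕ Fin q) ι ℝ)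
    (J : Matrix (Fin r) (Fin r) ℝ),
    W * Wi = 1 ∧ Wi * W = 1 ∧ T * Ti = 1 ∧ Ti * T = 1 ∧
    W * E * T = fromBlocks 1 0 0 0 ∧ W * G * T = fromBlocks J 0 0 1 ∧
    ∀ mu ∈ spectrum ℂ (toC J), mu.re < 0

/-- Existence of a stabilizing solution with closed loop in the form `HasStableForm`. -/
def RiccatiSolvable (E A : Matrix ι ι ℝ) (B : Matrix ι κ ℝ) (Q : Matrix ι ι ℝ) : Prop :=
  ∃ X, Eᵀ * X = Xᵀ * E ∧ riccati A (B * Bᵀ) Q X = 0 ∧ HasStableForm E (A - B * Bᵀ * X)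

section Coordinates
variable {W : Matrix σ ι ℝ} {Wi : Matrix ι σ ℝ} {T : Matrix ι σ ℝ} {Ti : Matrix σ ι ℝ}

theorem HasStableForm.of_equiv (h1 : W * Wi = 1) (h2 : Wi * W = 1) (h3 : T * Ti = 1)
    (h4 : Ti * T = 1) {E G : Matrix ι ι ℝ} (h : HasStableForm (W * E * T) (W * G * T)) :
    HasStableForm E G := by
  obtain ⟨r, q, V, Vi, U, Ui, J, a1, a2, a3, a4, hE, hG, hJ⟩ := h
  refine ⟨r, q, V * W, Wi * Vi, T * U, Ui * Ti, J, ?_, ?_, ?_, ?_, ?_, ?_, hJ⟩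
  · rw [Matrix.mul_assoc, ← Matrix.mul_assoc W, h1, Matrix.one_mul, a1]
  · rw [Matrix.mul_assoc, ← Matrix.mul_assoc Vi, a2, Matrix.one_mul, h2]
  · rw [Matrix.mul_assoc, ← Matrix.mul_assoc U, a3, Matrix.one_mul, h3]
  · rw [Matrix.mul_assoc, ← Matrix.mul_assoc Ti, h4, Matrix.one_mul, a4]
  · rw [← hE]; simp only [Matrix.mul_assoc]
  · rw [← hG]; simp only [Matrix.mul_assoc]

theorem eq_of_transpose_mul_mul_eq (h3 : T * Ti = 1) {M N : Matrix ι ι ℝ}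
    (h : Tᵀ * M * T = Tᵀ * N * T) : M = N := by
  have h3' : Tiᵀ * Tᵀ = 1 := by rw [← transpose_mul, h3, transpose_one]
  have : Tiᵀ * (Tᵀ * M * T) * Ti = Tiᵀ * (Tᵀ * N * T) * Ti := by rw [h]
  simpa [Matrix.mul_assoc, h3, ← Matrix.mul_assoc Tiᵀ, h3'] using this

/-- The change of coordinates `X = Wᵀ Y T⁻¹` in the Riccati equation. -/
theorem riccati_coordinates (h3 : T * Ti = 1) (h4 : Ti * T = 1) {A : Matrix ι ι ℝ}
    {B : Matrix ι κ ℝ} {Q : Matrix ι ι ℝ} {Y : Matrix σ σ ℝ}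
    (h : riccati (W * A * T) (W * B * (W * B)ᵀ) (Tᵀ * Q * T) Y = 0) :
    riccati A (B * Bᵀ) Q (Wᵀ * Y * Ti) = 0 := by
  refine eq_of_transpose_mul_mul_eq h3 ?_
  have h4' : Tᵀ * Tiᵀ = 1 := by rw [← transpose_mul, h4, transpose_one]
  have a4 : ∀ Z : Matrix σ σ ℝ, Tᵀ * (Tiᵀ * Z) = Z := fun Z => by
    rw [← Matrix.mul_assoc, h4', Matrix.one_mul]
  rw [Matrix.mul_zero, Matrix.zero_mul, ← h]
  simp only [riccati, transpose_mul, transpose_transpose, Matrix.mul_add, Matrix.mul_sub,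
    Matrix.add_mul, Matrix.sub_mul, Matrix.mul_assoc, h4, a4, Matrix.mul_one]

theorem closedLoop_coordinates (h4 : Ti * T = 1) (A : Matrix ι ι ℝ)
    (B : Matrix ι κ ℝ) (Y : Matrix σ σ ℝ) :
    W * (A - B * Bᵀ * (Wᵀ * Y * Ti)) * T = W * A * T - W * B * (W * B)ᵀ * Y := by
  simp only [transpose_mul, Matrix.mul_sub, Matrix.sub_mul, Matrix.mul_assoc, h4, Matrix.mul_one]

theorem RiccatiSolvable.of_equiv (h1 : W * Wi = 1) (h2 : Wi * W = 1) (h3 : T * Ti = 1)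
    (h4 : Ti * T = 1) {E A : Matrix ι ι ℝ} {B : Matrix ι κ ℝ} {Q : Matrix ι ι ℝ}
    (h : RiccatiSolvable (W * E * T) (W * A * T) (W * B) (Tᵀ * Q * T)) :
    RiccatiSolvable E A B Q := by
  obtain ⟨Y, hE, hY, hS⟩ := h
  refine ⟨Wᵀ * Y * Ti, ?_, riccati_coordinates h3 h4 hY, ?_⟩
  · refine eq_of_transpose_mul_mul_eq h3 ?_
    have h4' : Tᵀ * Tiᵀ = 1 := by rw [← transpose_mul, h4, transpose_one]
    have a4 : ∀ Z : Matrix σ σ ℝ, Tᵀ * (Tiᵀ * Z) = Z := fun Z => by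
      rw [← Matrix.mul_assoc, h4', Matrix.one_mul]
    simp only [transpose_mul, transpose_transpose, Matrix.mul_assoc, h4, a4, Matrix.mul_one]
      at hE ⊢
    exact hE
  · rw [← closedLoop_coordinates h4] at hS
    exact hS.of_equiv h1 h2 h3 h4

theorem eq_zero_of_toC_mulVec_eq_zero (h2 : Wi * W = 1) {x : ι → ℂ} (h : toC W *ᵥ x = 0) :
    x = 0 := by
  rw [← one_mulVec x, ← toC_one, ← h2, toC_mul, ← mulVec_mulVec, h, mulVec_zero]

/-- The test concerns left vectors, which transform by `Wᵀ`. -/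
theorem HautusStabilizable.equiv (h1 : W * Wi = 1) (h3 : T * Ti = 1)
    {E A : Matrix ι ι ℝ} {B : Matrix ι κ ℝ} (h : HautusStabilizable E A B) :
    HautusStabilizable (W * E * T) (W * A * T) (W * B) := by
  intro mu hmu y hy hB
  have h1' : Wiᵀ * Wᵀ = 1 := by rw [← transpose_mul, h1, transpose_one]
  have h3' : Tiᵀ * Tᵀ = 1 := by rw [← transpose_mul, h3, transpose_one]
  simp only [transpose_mul, toC_mul, ← mulVec_mulVec] at hy hB
  refine eq_zero_of_toC_mulVec_eq_zero h1' (h mu hmu _ ?_ hB)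
  refine sub_eq_zero.mp (eq_zero_of_toC_mulVec_eq_zero h3' ?_)
  rw [mulVec_sub, mulVec_smul, hy, sub_self]

/-- Eigenvectors transform by `(x, y) ↦ (T x, Wᵀ y)`. -/
theorem NoImaginaryEigenvalue.equiv (h1 : W * Wi = 1) (h2 : Wi * W = 1) (h3 : T * Ti = 1)
    (h4 : Ti * T = 1) {E A Q : Matrix ι ι ℝ} {B : Matrix ι κ ℝ}
    (h : NoImaginaryEigenvalue E A (B * Bᵀ) Q) :
    NoImaginaryEigenvalue (W * E * T) (W * A * T) (W * B * (W * B)ᵀ) (Tᵀ * Q * T) := by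
  intro mu hmu x y hx hy
  have h1' : Wiᵀ * Wᵀ = 1 := by rw [← transpose_mul, h1, transpose_one]
  have h3' : Tiᵀ * Tᵀ = 1 := by rw [← transpose_mul, h3, transpose_one]
  simp only [transpose_mul, toC_mul, ← mulVec_mulVec] at hx hy
  have key := h mu hmu (toC T *ᵥ x) (toC Wᵀ *ᵥ y) ?_ ?_
  · exact ⟨eq_zero_of_toC_mulVec_eq_zero h4 key.1, eq_zero_of_toC_mulVec_eq_zero h1' key.2⟩
  · refine sub_eq_zero.mp (eq_zero_of_toC_mulVec_eq_zero h2 ?_)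
    rw [mulVec_sub, mulVec_sub, mulVec_smul, ← hx, toC_mul, ← mulVec_mulVec, sub_self]
  · refine sub_eq_zero.mp (eq_zero_of_toC_mulVec_eq_zero h3' ?_)
    rw [mulVec_sub, mulVec_add, mulVec_neg, mulVec_smul, hy, sub_self]

end Coordinates

section Shift
variable {E A Q X0 : Matrix ι ι ℝ} {B : Matrix ι κ ℝ}

theorem HautusStabilizable.shift (h : HautusStabilizable E A B) (K : Matrix κ ι ℝ) :
    HautusStabilizable E (A - B * K) B := by
  intro mu hmu y hy hB
  refine h mu hmu y ?_ hB
  rw [← hy, transpose_sub, toC_sub, Matrix.sub_mulVec, transpose_mul, toC_mul, ← mulVec_mulVec,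
    hB, mulVec_zero, sub_zero]

/-- The substitution `(x, y) ↦ (x, y + X0 x)` carries eigenvectors of the shifted pencil to those of
the original one; `hE` matches the terms in `mu`. -/
theorem NoImaginaryEigenvalue.shift {R : Matrix ι ι ℝ} (hR : Rᵀ = R)
    (h : NoImaginaryEigenvalue E A R Q)
    (hE : Eᵀ * X0 = X0ᵀ * E) :
    NoImaginaryEigenvalue E (A - R * X0) R (riccati A R Q X0) := by
  intro mu hmu x y hx hy
  have hE' : ∀ v, toC Eᵀ *ᵥ (toC X0 *ᵥ v) = toC X0ᵀ *ᵥ (toC E *ᵥ v) := fun v => by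
    rw [mulVec_mulVec, ← toC_mul, hE, toC_mul, ← mulVec_mulVec]
  have key := h mu hmu x (y + toC X0 *ᵥ x) ?_ ?_
  · obtain ⟨rfl, h2⟩ := key
    exact ⟨rfl, by simpa using h2⟩
  · rw [← hx]
    simp only [toC_sub, toC_mul, Matrix.sub_mulVec, ← mulVec_mulVec, mulVec_add]
    abel
  · have hx' := congrArg (toC X0ᵀ *ᵥ ·) hx
    simp only [riccati, toC_add, transpose_sub, transpose_mul, hR, toC_sub, toC_mul,
      Matrix.sub_mulVec, ← mulVec_mulVec, mulVec_add, mulVec_sub, mulVec_smul,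
      Matrix.add_mulVec] at hx hy hx' ⊢
    rw [hE', smul_add, ← hx', ← sub_eq_zero]
    rw [← sub_eq_zero] at hy
    rw [← hy]
    abel

/-- The Riccati expression at `X0 + Y` equals that of the shifted data at `Y`, with the same closed
loop. Thus any admissible `X0`, not only a solution, may be used to simplify the data. -/
theorem RiccatiSolvable.of_shift (hE : Eᵀ * X0 = X0ᵀ * E)
    (h : RiccatiSolvable E (A - B * Bᵀ * X0) B (riccati A (B * Bᵀ) Q X0)) :
    RiccatiSolvable E A B Q := by
  obtain ⟨Y, hY, hric, hS⟩ := h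
  refine ⟨X0 + Y, ?_, ?_, ?_⟩
  · rw [Matrix.mul_add, transpose_add, Matrix.add_mul, hE, hY]
  · rw [← hric]
    have hR : (B * Bᵀ)ᵀ = B * Bᵀ := by simp
    generalize B * Bᵀ = R at hR
    simp only [riccati, transpose_add, transpose_sub, transpose_mul, hR]
    noncomm_ring
  · rwa [Matrix.mul_add, ← sub_sub]

end Shift
end Reduction

/-! ### Solvability for `E = diag(1, 0)`, and reduction to this case. -/

section Blocks
variable {r q m o : ℕ}

theorem fromBlocks_sub_fromBlocks {a b c d : Type*} (A A' : Matrix a b ℝ) (B B' : Matrix a c ℝ)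
    (C C' : Matrix d b ℝ) (D D' : Matrix d c ℝ) :
    fromBlocks A B C D - fromBlocks A' B' C' D' =
      fromBlocks (A - A') (B - B') (C - C') (D - D') := by
  ext (i | i) (j | j) <;> simp

theorem toC_transpose_eq_conjTranspose {a b : Type*} (M : Matrix a b ℝ) :
    toC Mᵀ = (toC M)ᴴ := by ext; simp

open scoped ComplexOrder in
/-- For an imaginary eigenvalue of a Hamiltonian matrix the input and output parts of the
eigenvector vanish. -/
theorem input_output_eq_zero_of_imaginary {A : Matrix (Fin q) (Fin q) ℝ}
    {B : Matrix (Fin q) (Fin m) ℝ} {C : Matrix (Fin o) (Fin q) ℝ} {mu : ℂ} (hmu : mu.re = 0)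
    {x y : Fin q → ℂ} (hx : toC A *ᵥ x - toC (B * Bᵀ) *ᵥ y = mu • x)
    (hy : toC (Cᵀ * C) *ᵥ x + toC Aᵀ *ᵥ y = -(mu • y)) :
    toC Bᵀ *ᵥ y = 0 ∧ toC C *ᵥ x = 0 := by
  have hmu' : star mu = -mu := Complex.ext (by simp [hmu]) (by simp)
  -- Pairing the equations with `y` and `x` and subtracting cancels the terms in `A` and `mu`,
  -- leaving `|Bᵀ y|² + |C x|² = 0`.
  have h1 := congrArg (star y ⬝ᵥ ·) hx
  have h2 := congrArg (star · ⬝ᵥ x) hy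
  simp only [toC_mul, toC_transpose_eq_conjTranspose, ← mulVec_mulVec, star_add, star_neg,
    star_smul, hmu', dotProduct_sub, add_dotProduct, neg_dotProduct, smul_dotProduct,
    dotProduct_smul, star_mulVec, conjTranspose_conjTranspose, ← dotProduct_mulVec] at h1 h2
  have h3 : star y ⬝ᵥ (toC B *ᵥ ((toC B)ᴴ *ᵥ y)) =
      star ((toC B)ᴴ *ᵥ y) ⬝ᵥ ((toC B)ᴴ *ᵥ y) := by
    rw [star_mulVec, conjTranspose_conjTranspose, ← dotProduct_mulVec]
  have h4 : star x ⬝ᵥ ((toC C)ᴴ *ᵥ (toC C *ᵥ x)) = star (toC C *ᵥ x) ⬝ᵥ (toC C *ᵥ x) := by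
    rw [star_mulVec, ← dotProduct_mulVec]
  rw [h3] at h1
  rw [h4] at h2
  have h5 : star ((toC B)ᴴ *ᵥ y) ⬝ᵥ ((toC B)ᴴ *ᵥ y) + star (toC C *ᵥ x) ⬝ᵥ (toC C *ᵥ x) = 0 := by
    simp only [smul_eq_mul] at h1 h2
    linear_combination h2 - h1
  obtain ⟨h6, h7⟩ := (add_eq_zero_iff_of_nonneg (dotProduct_star_self_nonneg _)
    (dotProduct_star_self_nonneg _)).mp h5
  rw [toC_transpose_eq_conjTranspose]
  exact ⟨dotProduct_star_self_eq_zero.mp h6, dotProduct_star_self_eq_zero.mp h7⟩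

/-- No symmetry of `X` is demanded, so the equation may be transformed by independent invertible
matrices on both sides of `A`. This turns `A` into `diag(-1, 0)`, whose only eigenvalue outside the
open left half-plane is 0. There the hypotheses of the ordinary Riccati theorem reduce to
injectivity, and a stable closed loop is invertible. -/
theorem exists_riccati_of_injective_ham (A : Matrix (Fin q) (Fin q) ℝ)
    (B : Matrix (Fin q) (Fin m) ℝ) (C : Matrix (Fin o) (Fin q) ℝ)
    (hinj : ∀ v, hamMatrix A (B * Bᵀ) (Cᵀ * C) *ᵥ v = 0 → v = 0) :
    ∃ X, riccati A (B * Bᵀ) (Cᵀ * C) X = 0 ∧ IsUnit (A - B * Bᵀ * X) := by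
  obtain ⟨V, U, e, hV, hU, hVU⟩ := exists_rank_normal_form A
  obtain ⟨Ui, hU1, hU2⟩ := isUnit_iff_exists.mp hU
  obtain ⟨Vi, hV1, hV2⟩ := isUnit_iff_exists.mp hV
  set p : Fin q → ℝ := fun i => Sum.elim (fun _ => -1) (fun _ => 0) (e i) with hp
  have hp0 : ∀ i, p i ≤ 0 := fun i => by
    rw [hp]; rcases h : e i with j | j <;> simp [h]
  -- The sign turns the identity block of the rank normal form into a stable block.
  set W := -V with hW
  have hWA : W * A * U = diagonal p := by
    rw [hW, Matrix.neg_mul, Matrix.neg_mul, hVU]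
    ext i j
    rw [diagonal_apply, hp, neg_apply, submatrix_apply]
    by_cases hij : i = j
    · subst hij
      rcases h : e i with k | k <;> simp [h]
    · have hne : e i ≠ e j := e.injective.ne hij
      rw [if_neg hij]
      rcases hi : e i with k | k <;> rcases hj : e j with l | l <;>
        simp_all
  have hinjC : ∀ x y : Fin q → ℂ, toC A *ᵥ x = 0 → toC Aᵀ *ᵥ y = 0 → toC Bᵀ *ᵥ y = 0 →
      toC C *ᵥ x = 0 → x = 0 ∧ y = 0 := by
    intro x y h1 h2 h3 h4
    have hreal : ∀ x y : Fin q → ℝ, A *ᵥ x = 0 → Aᵀ *ᵥ y = 0 → Bᵀ *ᵥ y = 0 →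
      C *ᵥ x = 0 → x = 0 ∧ y = 0 := by
      intro x y h1 h2 h3 h4
      have h := hinj (Sum.elim x y) (by
        rw [hamMatrix, fromBlocks_mulVec]
        simp only [Sum.elim_comp_inl, Sum.elim_comp_inr, Matrix.neg_mulVec, ← mulVec_mulVec,
          h1, h2, h3, h4, mulVec_zero, neg_zero, add_zero]
        ext (j | j) <;> rfl)
      exact ⟨funext fun j => congrFun h (Sum.inl j), funext fun j => congrFun h (Sum.inr j)⟩
    rw [toC_mulVec_eq_zero_iff] at h1 h2 h3 h4
    obtain ⟨a1, a2⟩ := hreal _ _ h1.1 h2.1 h3.1 h4.1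
    obtain ⟨b1, b2⟩ := hreal _ _ h1.2 h2.2 h3.2 h4.2
    exact ⟨funext fun j => Complex.ext (congrFun a1 j) (congrFun b1 j),
      funext fun j => Complex.ext (congrFun a2 j) (congrFun b2 j)⟩
  have hWi : (-Vi) * W = 1 := by rw [hW, neg_mul_neg, hV2]
  have hWi' : W * (-Vi) = 1 := by rw [hW, neg_mul_neg, hV1]
  have hWiT : (-Vi)ᵀ * Wᵀ = 1 := by rw [← transpose_mul, hWi', transpose_one]
  have hUiT : Uiᵀ * Uᵀ = 1 := by rw [← transpose_mul, hU1, transpose_one]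
  have hpC : ∀ (y : Fin q → ℂ) (i), (toC (diagonal p) *ᵥ y) i = (p i : ℂ) * y i := fun y i => by
    rw [show toC (diagonal p) = diagonal fun i => (p i : ℂ) by
      rw [toC, diagonal_map (map_zero _)]; rfl, mulVec_diagonal]
  have hpeig : ∀ (y : Fin q → ℂ) (mu : ℂ), 0 ≤ mu.re → toC (diagonal p) *ᵥ y = mu • y →
      toC (diagonal p) *ᵥ y = 0 := by
    intro y mu hmu h
    ext i
    have h1 := congrFun h i
    rw [hpC, Pi.smul_apply, smul_eq_mul] at h1
    rw [hpC]
    by_cases hy : y i = 0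
    · simp [hy]
    · have h2 := congrArg Complex.re (mul_right_cancel₀ hy h1)
      rw [Complex.ofReal_re] at h2
      rw [le_antisymm (hp0 i) (h2 ▸ hmu)]
      simp
  have hdT : (diagonal p)ᵀ = diagonal p := diagonal_transpose p
  have hAx : ∀ x, toC (diagonal p) *ᵥ x = 0 → toC A *ᵥ (toC U *ᵥ x) = 0 := fun x hx =>
    eq_zero_of_toC_mulVec_eq_zero hWi (by
      rwa [mulVec_mulVec, mulVec_mulVec, ← toC_mul, ← toC_mul, hWA])
  have hAy : ∀ y, toC (diagonal p) *ᵥ y = 0 → toC Aᵀ *ᵥ (toC Wᵀ *ᵥ y) = 0 := fun y hy =>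
    eq_zero_of_toC_mulVec_eq_zero hUiT (by
      rwa [mulVec_mulVec, mulVec_mulVec, ← toC_mul, ← toC_mul, ← transpose_mul,
        ← transpose_mul, ← Matrix.mul_assoc, hWA, hdT])
  have hQ : Uᵀ * (Cᵀ * C) * U = (C * U)ᵀ * (C * U) := by
    simp only [transpose_mul, Matrix.mul_assoc]
  obtain ⟨Y, hYs, hY, hst⟩ := exists_stabilizing_riccati (diagonal p) (W * B)
    (Uᵀ * (Cᵀ * C) * U) (by simp [Matrix.mul_assoc])
    (by
      intro mu hmu y hy hB
      rw [hdT] at hy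
      rw [transpose_mul, toC_mul, ← mulVec_mulVec] at hB
      exact eq_zero_of_toC_mulVec_eq_zero hWiT
        (hinjC 0 _ (mulVec_zero _) (hAy y (hpeig y mu hmu hy)) hB (mulVec_zero _)).2)
    (by
      intro mu hmu x y hx hy
      have hmu' : (-mu).re = 0 := by simp [hmu]
      rw [hQ] at hy
      obtain ⟨h1, h2⟩ := input_output_eq_zero_of_imaginary hmu hx hy
      have h3 : toC (diagonal p) *ᵥ x = mu • x := by
        rw [← hx, toC_mul, ← mulVec_mulVec, h1, mulVec_zero, sub_zero]
      have h4 : toC (diagonal p) *ᵥ y = (-mu) • y := by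
        rw [neg_smul, ← hy, toC_mul, ← mulVec_mulVec, h2, mulVec_zero, zero_add, hdT]
      rw [transpose_mul, toC_mul, ← mulVec_mulVec] at h1
      rw [toC_mul, ← mulVec_mulVec] at h2
      obtain ⟨h5, h6⟩ := hinjC _ _ (hAx x (hpeig x mu hmu.ge h3))
        (hAy y (hpeig y (-mu) hmu'.ge h4)) h1 h2
      exact ⟨eq_zero_of_toC_mulVec_eq_zero hU2 h5, eq_zero_of_toC_mulVec_eq_zero hWiT h6⟩)
  refine ⟨Wᵀ * Y * Ui, riccati_coordinates hU1 hU2 ?_, ?_⟩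
  · rw [hWA, riccati, hYs]; exact hY
  · have h1 : IsUnit (toC (diagonal p - W * B * (W * B)ᵀ * Y)) := by
      by_contra h
      have := hst 0 ((spectrum.zero_mem_iff ℂ).mpr h)
      simp at this
    rw [isUnit_iff_isUnit_det, isUnit_iff_ne_zero, toC, ← RingHom.mapMatrix_apply,
      ← RingHom.map_det, map_ne_zero_iff _ Complex.ofRealHom.injective] at h1
    rw [isUnit_iff_isUnit_det, isUnit_iff_ne_zero]
    rw [← hWA, ← closedLoop_coordinates hU2, det_mul, det_mul] at h1
    exact right_ne_zero_of_mul (left_ne_zero_of_mul h1)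

/-- The Riccati equation in fully decoupled coordinates. -/
theorem riccatiSolvable_decoupled (A Q : Matrix (Fin r) (Fin r) ℝ) (hQ : Qᵀ = Q)
    (B : Matrix (Fin r ⊕ Fin q) (Fin m) ℝ)
    (hs : HautusStabilizable (fromBlocks 1 0 0 0) (fromBlocks A 0 0 1) B)
    (hn : NoImaginaryEigenvalue (fromBlocks 1 0 0 0) (fromBlocks A 0 0 1) (B * Bᵀ)
      (fromBlocks Q 0 0 0)) :
    RiccatiSolvable (fromBlocks 1 0 0 0) (fromBlocks A 0 0 1) B (fromBlocks Q 0 0 0) := by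
  obtain ⟨B1, B2, rfl⟩ : ∃ B1 B2, B = fromRows B1 B2 := ⟨_, _, (fromRows_toRows B).symm⟩
  have hR : fromRows B1 B2 * (fromRows B1 B2)ᵀ =
      fromBlocks (B1 * B1ᵀ) (B1 * B2ᵀ) (B2 * B1ᵀ) (B2 * B2ᵀ) := by
    rw [transpose_fromRows, fromRows_mul_fromCols]
  have hBT : ∀ y : Fin r → ℂ, toC (fromRows B1 B2)ᵀ *ᵥ Sum.elim y 0 = toC B1ᵀ *ᵥ y := by
    intro y
    ext i
    simp [mulVec, dotProduct]
  have h0 : (Sum.elim 0 0 : Fin r ⊕ Fin q → ℂ) = 0 := by ext (j | j) <;> rfl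
  obtain ⟨X, hXs, hX, hst⟩ := exists_stabilizing_riccati A B1 Q hQ
    (by
      intro mu hmu y hy hB
      have h := hs mu hmu (Sum.elim y 0) (by
        simp only [fromBlocks_transpose, toC_fromBlocks, fromBlocks_mulVec, transpose_zero,
          transpose_one, toC_one, toC_zero, Sum.elim_comp_inl, Sum.elim_comp_inr, mulVec_zero,
          zero_mulVec, one_mulVec, add_zero, hy]
        ext (j | j) <;> simp) (by rw [hBT, hB])
      exact funext fun j => congrFun h (Sum.inl j))
    (by
      intro mu hmu x y hx hy
      -- The fast component of `x` is the one forced by the algebraic row `x₂ - B2 B1ᵀ y = 0`.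
      have h := hn mu hmu (Sum.elim x (toC (B2 * B1ᵀ) *ᵥ y)) (Sum.elim y 0) (by
          simp only [hR, toC_fromBlocks, fromBlocks_mulVec, toC_one, toC_zero, Sum.elim_comp_inl,
            Sum.elim_comp_inr, mulVec_zero, zero_mulVec, one_mulVec, add_zero, zero_add]
          ext (j | j)
          · simpa using congrFun hx j
          · simp) (by
          simp only [fromBlocks_transpose, toC_fromBlocks, fromBlocks_mulVec, transpose_zero,
            transpose_one, toC_one, toC_zero, Sum.elim_comp_inl, Sum.elim_comp_inr, mulVec_zero,
            zero_mulVec, one_mulVec, add_zero]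
          ext (j | j)
          · simpa using congrFun hy j
          · simp)
      exact ⟨funext fun j => congrFun h.1 (Sum.inl j), funext fun j => congrFun h.2 (Sum.inl j)⟩)
  -- The closed loop has the lower left block `-B2 B1ᵀ X`, which this column operation clears.
  refine ⟨fromBlocks X 0 0 0, ?_, ?_, r, q, 1, 1, fromBlocks 1 0 (B2 * B1ᵀ * X) 1,
    fromBlocks 1 0 (-(B2 * B1ᵀ * X)) 1, A - B1 * B1ᵀ * X, by simp, by simp, ?_, ?_, ?_, ?_, hst⟩
  · simp [fromBlocks_transpose, fromBlocks_multiply, hXs]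
  · rw [hR, riccati]
    simp only [fromBlocks_transpose, fromBlocks_multiply, hXs, fromBlocks_add,
      fromBlocks_sub_fromBlocks,
      transpose_zero, transpose_one, Matrix.mul_zero, Matrix.zero_mul, add_zero, sub_zero,
      Matrix.mul_one, hX]
    rw [← fromBlocks_zero, ← hX]
  · simp [fromBlocks_multiply, fromBlocks_one]
  · simp [fromBlocks_multiply, fromBlocks_one]
  · simp [fromBlocks_multiply]
  · rw [hR]
    simp [fromBlocks_multiply, sub_eq_add_neg, fromBlocks_add, fromBlocks_neg]

/-- Reduction to decoupled coordinates when the fast block of `A` is invertible. -/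
theorem riccatiSolvable_of_isUnit_of_diagonal {A1 : Matrix (Fin r) (Fin r) ℝ}
    {A2 : Matrix (Fin r) (Fin q) ℝ} {A3 : Matrix (Fin q) (Fin r) ℝ} {A4 : Matrix (Fin q) (Fin q) ℝ}
    (hA : IsUnit A4) {Q : Matrix (Fin r) (Fin r) ℝ} (hQ : Qᵀ = Q)
    {B : Matrix (Fin r ⊕ Fin q) (Fin m) ℝ}
    (hs : HautusStabilizable (fromBlocks 1 0 0 0) (fromBlocks A1 A2 A3 A4) B)
    (hn : NoImaginaryEigenvalue (fromBlocks 1 0 0 0) (fromBlocks A1 A2 A3 A4) (B * Bᵀ)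
      (fromBlocks Q 0 0 0)) :
    RiccatiSolvable (fromBlocks 1 0 0 0) (fromBlocks A1 A2 A3 A4) B (fromBlocks Q 0 0 0) := by
  obtain ⟨A4i, h1, h2⟩ := isUnit_iff_exists.mp hA
  -- Block elimination leaves the Schur complement of `A4` as slow matrix and changes neither `E`
  -- nor the weight.
  set W : Matrix (Fin r ⊕ Fin q) (Fin r ⊕ Fin q) ℝ := fromBlocks 1 (-(A2 * A4i)) 0 A4i with hW
  set Wi : Matrix (Fin r ⊕ Fin q) (Fin r ⊕ Fin q) ℝ := fromBlocks 1 A2 0 A4 with hWi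
  set T : Matrix (Fin r ⊕ Fin q) (Fin r ⊕ Fin q) ℝ := fromBlocks 1 0 (-(A4i * A3)) 1 with hT
  set Ti : Matrix (Fin r ⊕ Fin q) (Fin r ⊕ Fin q) ℝ := fromBlocks 1 0 (A4i * A3) 1 with hTi
  have w1 : W * Wi = 1 := by
    simp [hW, hWi, fromBlocks_multiply, Matrix.mul_assoc, h2, fromBlocks_one]
  have w2 : Wi * W = 1 := by
    simp [hW, hWi, fromBlocks_multiply, h1, fromBlocks_one]
  have t1 : T * Ti = 1 := by simp [hT, hTi, fromBlocks_multiply, fromBlocks_one]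
  have t2 : Ti * T = 1 := by simp [hT, hTi, fromBlocks_multiply, fromBlocks_one]
  have hE : W * fromBlocks 1 0 0 0 * T = fromBlocks 1 0 0 0 := by
    simp [hW, hT, fromBlocks_multiply]
  have hA' : W * fromBlocks A1 A2 A3 A4 * T = fromBlocks (A1 - A2 * A4i * A3) 0 0 1 := by
    simp [hW, hT, fromBlocks_multiply, Matrix.mul_assoc, h2, sub_eq_add_neg]
  have hQ' : Tᵀ * fromBlocks Q 0 0 0 * T = fromBlocks Q 0 0 0 := by
    simp [hT, fromBlocks_multiply, fromBlocks_transpose]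
  refine RiccatiSolvable.of_equiv w1 w2 t1 t2 ?_
  have hs' := hs.equiv (W := W) (T := T) w1 t1
  have hn' := hn.equiv w1 w2 t1 t2
  rw [hE, hA'] at hs' hn' ⊢
  rw [hQ'] at hn' ⊢
  exact riccatiSolvable_decoupled _ _ hQ _ hs' hn'

/-- A shift by a lower left block `M` leaves `A4` unchanged and adds `A4ᵀ M` to `Q3`; since `A4` is
invertible, `M` can be chosen to remove `Q3`. -/
theorem riccatiSolvable_of_isUnit {A1 : Matrix (Fin r) (Fin r) ℝ}
    {A2 : Matrix (Fin r) (Fin q) ℝ} {A3 : Matrix (Fin q) (Fin r) ℝ} {A4 : Matrix (Fin q) (Fin q) ℝ}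
    (hA : IsUnit A4) {Q1 : Matrix (Fin r) (Fin r) ℝ} (hQ : Q1ᵀ = Q1) {Q3 : Matrix (Fin q) (Fin r) ℝ}
    {B : Matrix (Fin r ⊕ Fin q) (Fin m) ℝ}
    (hs : HautusStabilizable (fromBlocks 1 0 0 0) (fromBlocks A1 A2 A3 A4) B)
    (hn : NoImaginaryEigenvalue (fromBlocks 1 0 0 0) (fromBlocks A1 A2 A3 A4) (B * Bᵀ)
      (fromBlocks Q1 Q3ᵀ Q3 0)) :
    RiccatiSolvable (fromBlocks 1 0 0 0) (fromBlocks A1 A2 A3 A4) B (fromBlocks Q1 Q3ᵀ Q3 0) := by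
  obtain ⟨A4i, h1, h2⟩ := isUnit_iff_exists.mp hA
  have h1' : A4iᵀ * A4ᵀ = 1 := by rw [← transpose_mul, h1, transpose_one]
  have h2' : A4ᵀ * A4iᵀ = 1 := by rw [← transpose_mul, h2, transpose_one]
  set M := -(A4iᵀ * Q3) with hM
  set X0 : Matrix (Fin r ⊕ Fin q) (Fin r ⊕ Fin q) ℝ := fromBlocks 0 0 M 0 with hX0
  obtain ⟨B1, B2, rfl⟩ : ∃ B1 B2, B = fromRows B1 B2 := ⟨_, _, (fromRows_toRows B).symm⟩
  have hR : fromRows B1 B2 * (fromRows B1 B2)ᵀ =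
      fromBlocks (B1 * B1ᵀ) (B1 * B2ᵀ) (B2 * B1ᵀ) (B2 * B2ᵀ) := by
    rw [transpose_fromRows, fromRows_mul_fromCols]
  have hE : (fromBlocks 1 0 0 0)ᵀ * X0 = X0ᵀ * fromBlocks 1 0 0 0 := by
    simp [hX0, fromBlocks_multiply, fromBlocks_transpose]
  have hA' : fromBlocks A1 A2 A3 A4 - fromRows B1 B2 * (fromRows B1 B2)ᵀ * X0 =
      fromBlocks (A1 - B1 * B2ᵀ * M) A2 (A3 - B2 * B2ᵀ * M) A4 := by
    rw [hR, hX0, fromBlocks_multiply, fromBlocks_sub_fromBlocks]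
    simp
  have hQ3 : A4ᵀ * M + Q3 = 0 := by
    rw [hM, Matrix.mul_neg, ← Matrix.mul_assoc, h2', Matrix.one_mul, neg_add_cancel]
  have hQ3' : Mᵀ * A4 + Q3ᵀ = 0 := by
    rw [← transpose_zero, ← hQ3, transpose_add, transpose_mul, transpose_transpose]
  have hQ' : riccati (fromBlocks A1 A2 A3 A4) (fromRows B1 B2 * (fromRows B1 B2)ᵀ)
      (fromBlocks Q1 Q3ᵀ Q3 0) X0 =
      fromBlocks (A3ᵀ * M + Mᵀ * A3 - Mᵀ * (B2 * B2ᵀ) * M + Q1) 0 0 0 := by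
    rw [hR, hX0, riccati]
    simp only [fromBlocks_transpose, fromBlocks_multiply, fromBlocks_add,
      fromBlocks_sub_fromBlocks, transpose_zero, Matrix.mul_zero, Matrix.zero_mul, add_zero,
      sub_zero, zero_add, hQ3, hQ3']
  refine RiccatiSolvable.of_shift hE ?_
  have hs' := hs.shift ((fromRows B1 B2)ᵀ * X0)
  rw [← Matrix.mul_assoc] at hs'
  have hn' := hn.shift (by rw [transpose_mul, transpose_transpose]) hE
  rw [hA'] at hs' hn' ⊢
  rw [hQ'] at hn' ⊢
  refine riccatiSolvable_of_isUnit_of_diagonal hA ?_ hs' hn'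
  simp only [transpose_add, transpose_sub, transpose_mul, transpose_transpose, hQ,
    Matrix.mul_assoc]
  abel

/-- The generalized Riccati equation when `E = diag(1, 0)`. -/
theorem riccatiSolvable_of_blocks {A : Matrix (Fin r ⊕ Fin q) (Fin r ⊕ Fin q) ℝ}
    {B : Matrix (Fin r ⊕ Fin q) (Fin m) ℝ} {C : Matrix (Fin o) (Fin r ⊕ Fin q) ℝ}
    (hs : HautusStabilizable (fromBlocks 1 0 0 0) A B)
    (hn : NoImaginaryEigenvalue (fromBlocks 1 0 0 0) A (B * Bᵀ) (Cᵀ * C))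
    (hi : ∀ x y u v, (fromBlocks 1 0 0 0 : Matrix (Fin r ⊕ Fin q) (Fin r ⊕ Fin q) ℝ) *ᵥ x = 0 →
      (fromBlocks 1 0 0 0 : Matrix (Fin r ⊕ Fin q) (Fin r ⊕ Fin q) ℝ)ᵀ *ᵥ y = 0 →
      A *ᵥ x - (B * Bᵀ) *ᵥ y +
        (fromBlocks 1 0 0 0 : Matrix (Fin r ⊕ Fin q) (Fin r ⊕ Fin q) ℝ) *ᵥ u = 0 →
      (Cᵀ * C) *ᵥ x + Aᵀ *ᵥ y -
        (fromBlocks 1 0 0 0 : Matrix (Fin r ⊕ Fin q) (Fin r ⊕ Fin q) ℝ)ᵀ *ᵥ v = 0 → x = 0 ∧ y = 0) :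
    RiccatiSolvable (fromBlocks 1 0 0 0) A B (Cᵀ * C) := by
  obtain ⟨A1, A2, A3, A4, rfl⟩ : ∃ A1 A2 A3 A4, A = fromBlocks A1 A2 A3 A4 :=
    ⟨_, _, _, _, (fromBlocks_toBlocks A).symm⟩
  obtain ⟨B1, B2, rfl⟩ : ∃ B1 B2, B = fromRows B1 B2 := ⟨_, _, (fromRows_toRows B).symm⟩
  obtain ⟨C1, C2, rfl⟩ : ∃ C1 C2, C = fromCols C1 C2 := ⟨_, _, (fromCols_toCols C).symm⟩
  have hR : fromRows B1 B2 * (fromRows B1 B2)ᵀ =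
      fromBlocks (B1 * B1ᵀ) (B1 * B2ᵀ) (B2 * B1ᵀ) (B2 * B2ᵀ) := by
    rw [transpose_fromRows, fromRows_mul_fromCols]
  have hQ : (fromCols C1 C2)ᵀ * fromCols C1 C2 =
      fromBlocks (C1ᵀ * C1) (C1ᵀ * C2) (C2ᵀ * C1) (C2ᵀ * C2) := by
    rw [transpose_fromCols, fromRows_mul_fromCols]
  have hinj : ∀ v, hamMatrix A4 (B2 * B2ᵀ) (C2ᵀ * C2) *ᵥ v = 0 → v = 0 := by
    intro v hv
    rw [hamMatrix, fromBlocks_mulVec] at hv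
    have hv1 := fun j => congrFun hv (Sum.inl j)
    have hv2 := fun j => congrFun hv (Sum.inr j)
    set x := v ∘ Sum.inl
    set y := v ∘ Sum.inr
    -- The last two vectors absorb the slow rows, so that only the fast Hamiltonian matrix
    -- constrains `x` and `y`.
    have key := hi (Sum.elim 0 x) (Sum.elim 0 y)
      (Sum.elim (-(A2 *ᵥ x) + (B1 * B2ᵀ) *ᵥ y) 0) (Sum.elim ((C1ᵀ * C2) *ᵥ x + A3ᵀ *ᵥ y) 0)
      (by simp only [fromBlocks_mulVec]; ext (j | j) <;> simp)
      (by simp only [fromBlocks_transpose, fromBlocks_mulVec]; ext (j | j) <;> simp)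
      (by
        simp only [hR, fromBlocks_mulVec]
        ext (j | j)
        · simp
        · simpa [sub_eq_add_neg, Matrix.neg_mulVec] using hv1 j)
      (by
        simp only [hQ, fromBlocks_mulVec, fromBlocks_transpose]
        ext (j | j)
        · simp
        · have := hv2 j
          simp [Matrix.neg_mulVec] at this
          simp
          linarith)
    ext (j | j)
    · exact congrFun key.1 (Sum.inr j)
    · exact congrFun key.2 (Sum.inr j)
  obtain ⟨X4, hX4, hu⟩ := exists_riccati_of_injective_ham A4 B2 C2 hinj
  -- Admissible because `Eᵀ X0 = 0`. The shift makes the fast weight zero and the fast block of `A`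
  -- invertible.
  set X0 : Matrix (Fin r ⊕ Fin q) (Fin r ⊕ Fin q) ℝ := fromBlocks 0 0 0 X4 with hX0
  have hE : (fromBlocks 1 0 0 0)ᵀ * X0 = X0ᵀ * fromBlocks 1 0 0 0 := by
    simp [hX0, fromBlocks_multiply, fromBlocks_transpose]
  have hA' : fromBlocks A1 A2 A3 A4 - fromRows B1 B2 * (fromRows B1 B2)ᵀ * X0 =
      fromBlocks A1 (A2 - B1 * B2ᵀ * X4) A3 (A4 - B2 * B2ᵀ * X4) := by
    rw [hR, hX0, fromBlocks_multiply, fromBlocks_sub_fromBlocks]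
    simp
  have hQ' : riccati (fromBlocks A1 A2 A3 A4) (fromRows B1 B2 * (fromRows B1 B2)ᵀ)
      ((fromCols C1 C2)ᵀ * fromCols C1 C2) X0 =
      fromBlocks (C1ᵀ * C1) (X4ᵀ * A3 + C2ᵀ * C1)ᵀ (X4ᵀ * A3 + C2ᵀ * C1) 0 := by
    rw [riccati] at hX4
    rw [hR, hQ, hX0, riccati]
    simp only [fromBlocks_transpose, fromBlocks_multiply, fromBlocks_add,
      fromBlocks_sub_fromBlocks, transpose_zero, Matrix.mul_zero, Matrix.zero_mul, add_zero,
      sub_zero, zero_add, hX4, transpose_add, transpose_mul, transpose_transpose]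
  refine RiccatiSolvable.of_shift hE ?_
  have hs' := hs.shift ((fromRows B1 B2)ᵀ * X0)
  rw [← Matrix.mul_assoc] at hs'
  have hn' := hn.shift (by rw [transpose_mul, transpose_transpose]) hE
  rw [hA'] at hs' hn' ⊢
  rw [hQ'] at hn' ⊢
  exact riccatiSolvable_of_isUnit hu (by simp) hs' hn'

/-- Solvability of the generalized Riccati equation from vector conditions on the Hamiltonian
pencil. -/
theorem riccatiSolvable_of_hautus {n : ℕ} {E A : Matrix (Fin n) (Fin n) ℝ}
    {B : Matrix (Fin n) (Fin m) ℝ} {C : Matrix (Fin o) (Fin n) ℝ}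
    (hs : HautusStabilizable E A B)
    (hn : NoImaginaryEigenvalue E A (B * Bᵀ) (Cᵀ * C))
    (hi : ∀ x y u v, E *ᵥ x = 0 → Eᵀ *ᵥ y = 0 → A *ᵥ x - (B * Bᵀ) *ᵥ y + E *ᵥ u = 0 →
      (Cᵀ * C) *ᵥ x + Aᵀ *ᵥ y - Eᵀ *ᵥ v = 0 → x = 0 ∧ y = 0) :
    RiccatiSolvable E A B (Cᵀ * C) := by
  obtain ⟨V, U, e, hV, hU, hVU⟩ := exists_rank_normal_form E
  obtain ⟨Ui, hU1, hU2⟩ := isUnit_iff_exists.mp hU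
  obtain ⟨Vi, hV1, hV2⟩ := isUnit_iff_exists.mp hV
  set W := V.submatrix e.symm id with hW
  set Wi := Vi.submatrix id e.symm with hWi
  set T := U.submatrix id e.symm with hT
  set Ti := Ui.submatrix e.symm id with hTi
  have w1 : W * Wi = 1 := by
    rw [hW, hWi, ← submatrix_mul _ _ _ _ _ Function.bijective_id, hV1]; simp
  have w2 : Wi * W = 1 := by
    rw [hW, hWi, submatrix_mul_equiv, hV2]; simp
  have t1 : T * Ti = 1 := by
    rw [hT, hTi, submatrix_mul_equiv, hU1]; simp
  have t2 : Ti * T = 1 := by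
    rw [hT, hTi, ← submatrix_mul _ _ _ _ _ Function.bijective_id, hU2]; simp
  have hE : W * E * T = fromBlocks 1 0 0 0 := by
    have : W * E * T = (V * E * U).submatrix e.symm e.symm := by
      ext i j
      simp [hW, hT, Matrix.mul_apply]
    rw [this, hVU]
    simp
  have w1' : Wiᵀ * Wᵀ = 1 := by rw [← transpose_mul, w1, transpose_one]
  have hQ : Tᵀ * (Cᵀ * C) * T = (C * T)ᵀ * (C * T) := by
    simp only [transpose_mul, Matrix.mul_assoc]
  have inj : ∀ {a b : Type} [Fintype a] [Fintype b] [DecidableEq b] {M : Matrix a b ℝ}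
      {N : Matrix b a ℝ}, N * M = 1 → ∀ {x}, M *ᵥ x = 0 → x = 0 := by
    intro a b _ _ _ M N h x hx
    rw [← one_mulVec x, ← h, ← mulVec_mulVec, hx, mulVec_zero]
  have t1' : Tiᵀ * Tᵀ = 1 := by rw [← transpose_mul, t1, transpose_one]
  refine RiccatiSolvable.of_equiv w1 w2 t1 t2 ?_
  have hs' := hs.equiv (W := W) (T := T) w1 t1
  have hn' := hn.equiv w1 w2 t1 t2
  rw [hQ] at hn' ⊢
  have hi' : ∀ x y u v, (W * E * T) *ᵥ x = 0 → (W * E * T)ᵀ *ᵥ y = 0 →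
      (W * A * T) *ᵥ x - (W * B * (W * B)ᵀ) *ᵥ y + (W * E * T) *ᵥ u = 0 →
      ((C * T)ᵀ * (C * T)) *ᵥ x + (W * A * T)ᵀ *ᵥ y - (W * E * T)ᵀ *ᵥ v = 0 →
      x = 0 ∧ y = 0 := by
    intro x y u v h1 h2 h3 h4
    have key := hi (T *ᵥ x) (Wᵀ *ᵥ y) (T *ᵥ u) (Wᵀ *ᵥ v)
      (inj w2 (by rw [← h1]; simp only [← mulVec_mulVec]))
      (inj t1' (by rw [← h2]; simp only [transpose_mul, ← mulVec_mulVec]))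
      (inj w2 (by
        rw [← h3]
        simp only [transpose_mul, ← mulVec_mulVec, mulVec_add, mulVec_sub]))
      (inj t1' (by
        rw [← h4]
        simp only [transpose_mul, ← mulVec_mulVec, mulVec_add, mulVec_sub]))
    exact ⟨inj t2 key.1, inj w1' key.2⟩
  rw [hE] at hs' hn' hi' ⊢
  exact riccatiSolvable_of_blocks hs' hn' hi'

end Blocks

/-! ### Regularity, impulses and eigenvalues of pencils; the Hamiltonian pencil. -/

section Pencils
variable {ι : Type*} [Fintype ι] [DecidableEq ι]

/-- Impulse-freeness in terms of kernels. -/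
theorem isImpulseFree_iff {E A : Matrix ι ι ℝ} :
    IsImpulseFree E A ↔ ∀ x y, E *ᵥ x = 0 → A *ᵥ x + E *ᵥ y = 0 → x = 0 := by
  set M := fromBlocks E 0 A E with hM
  set P : Matrix (ι ⊕ ι) ι ℝ := fromRows 0 1 with hP
  have hPv : ∀ y, P.mulVecLin y = Sum.elim (0 : ι → ℝ) y := fun y => by
    rw [mulVecLin_apply, hP, fromRows_mulVec, zero_mulVec, one_mulVec]
  have hPinj : Function.Injective P.mulVecLin := fun a b hab => by
    rw [hPv, hPv] at hab
    exact funext fun j => congrFun hab (Sum.inr j)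
  have hMv : ∀ x y, M.mulVecLin (Sum.elim x y) = Sum.elim (E *ᵥ x) (A *ᵥ x + E *ᵥ y) :=
    fun x y => by
      rw [mulVecLin_apply, hM, fromBlocks_mulVec]
      simp
  set K := (LinearMap.ker E.mulVecLin).map P.mulVecLin with hK
  -- The kernel of the block matrix always contains `0 × ker E`; by rank-nullity the rank condition
  -- says that it is no larger.
  have hKle : K ≤ LinearMap.ker M.mulVecLin := by
    rintro _ ⟨y, hy, rfl⟩
    have hy' : E *ᵥ y = 0 := hy
    rw [LinearMap.mem_ker, hPv, hMv, hy', mulVec_zero, mulVec_zero, add_zero]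
    ext (j | j) <;> rfl
  have hKf : Module.finrank ℝ K = Module.finrank ℝ (LinearMap.ker E.mulVecLin) :=
    (Submodule.equivMapOfInjective _ hPinj _).finrank_eq.symm
  have h1 : M.rank + _ = _ := LinearMap.finrank_range_add_finrank_ker M.mulVecLin
  have h2 : E.rank + _ = _ := LinearMap.finrank_range_add_finrank_ker E.mulVecLin
  rw [Module.finrank_fintype_fun_eq_card] at h1 h2
  rw [Fintype.card_sum] at h1
  have h3 : IsImpulseFree E A ↔ K = LinearMap.ker M.mulVecLin := by
    constructor
    · intro h
      refine Submodule.eq_of_le_of_finrank_eq hKle ?_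
      rw [IsImpulseFree, ← hM] at h
      omega
    · intro h
      rw [h] at hKf
      rw [IsImpulseFree, ← hM]
      omega
  rw [h3]
  constructor
  · intro h x y hx hy
    have hmem : Sum.elim x y ∈ K := by
      rw [h, LinearMap.mem_ker, hMv, hx, hy]
      ext (j | j) <;> rfl
    obtain ⟨z, -, hz⟩ := hmem
    rw [hPv] at hz
    exact funext fun j => (congrFun hz (Sum.inl j)).symm
  · intro h
    refine le_antisymm hKle fun v hv => ?_
    rw [← Sum.elim_comp_inl_inr v, LinearMap.mem_ker, hMv] at hv
    have hx : E *ᵥ (v ∘ Sum.inl) = 0 := funext fun j => congrFun hv (Sum.inl j)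
    have hy : A *ᵥ (v ∘ Sum.inl) + E *ᵥ (v ∘ Sum.inr) = 0 :=
      funext fun j => congrFun hv (Sum.inr j)
    have hx0 := h _ _ hx hy
    refine ⟨v ∘ Sum.inr, ?_, ?_⟩
    · rw [hx0, mulVec_zero, zero_add] at hy
      exact hy
    · rw [hPv, ← hx0, Sum.elim_comp_inl_inr]

theorem IsImpulseFree.transpose {E A : Matrix ι ι ℝ} (h : IsImpulseFree E A) :
    IsImpulseFree Eᵀ Aᵀ := by
  rw [IsImpulseFree] at h ⊢
  rw [rank_transpose, ← h, ← rank_transpose (fromBlocks E 0 A E), fromBlocks_transpose,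
    ← rank_submatrix (fromBlocks Eᵀ Aᵀ 0ᵀ Eᵀ) (Equiv.sumComm ι ι) (Equiv.sumComm ι ι)]
  congr 1
  ext (i | i) (j | j) <;> simp

/-- The finite eigenvalues of a finite dynamics stable pair lie in the open left half-plane. -/
theorem IsFiniteDynamicsStable.re_neg {E A : Matrix ι ι ℝ} (h : IsFiniteDynamicsStable E A)
    {mu : ℂ} {v : ι → ℂ} (hv : mu • (toC E *ᵥ v) = toC A *ᵥ v) (hv0 : v ≠ 0) : mu.re < 0 := by
  obtain ⟨-, r, q, e, J, N, ⟨⟨k, hk⟩, W, T, hW, hT, hE, hA⟩, hJ⟩ := h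
  obtain ⟨Ti, hT1, hT2⟩ := isUnit_iff_exists.mp hT
  set w := Ti *ᵥ v with hw
  have hvw : v = T *ᵥ w := by rw [hw, mulVec_mulVec, hT1, one_mulVec]
  have hw0 : w ≠ 0 := fun h0 => hv0 (by rw [hvw, h0, mulVec_zero])
  have h1 := congrArg (W *ᵥ ·) hv
  simp only [mulVec_smul, hvw, mulVec_mulVec, ← Matrix.mul_assoc, hE, hA] at h1
  have h2 : ∀ M : Matrix (Fin r ⊕ Fin q) (Fin r ⊕ Fin q) ℂ,
      (reindex e e M *ᵥ w) ∘ e = M *ᵥ (w ∘ e) := fun M => by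
    rw [reindex_apply, submatrix_mulVec_equiv]
    ext i
    simp
  have h3 : mu • (fromBlocks 1 0 0 N *ᵥ (w ∘ e)) = fromBlocks J 0 0 1 *ᵥ (w ∘ e) := by
    rw [← h2, ← h2, ← h1]
    rfl
  rw [fromBlocks_mulVec, fromBlocks_mulVec] at h3
  simp only [one_mulVec, zero_mulVec, add_zero, zero_add] at h3
  set a := (w ∘ e) ∘ Sum.inl with ha
  set b := (w ∘ e) ∘ Sum.inr with hb
  have h4 : J *ᵥ a = mu • a := funext fun j => (congrFun h3 (Sum.inl j)).symm
  have h5 : b = (mu • N) *ᵥ b := by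
    rw [smul_mulVec]
    exact funext fun j => (congrFun h3 (Sum.inr j)).symm
  -- Iterating `b = mu N b` kills the fast component, as `N` is nilpotent.
  have h6 : ∀ i : ℕ, b = ((mu • N) ^ i) *ᵥ b := by
    intro i
    induction i with
    | zero => simp
    | succ i ih => rw [pow_succ, ← mulVec_mulVec, ← h5, ← ih]
  have hb0 : b = 0 := by rw [h6 k, smul_pow, hk, smul_zero, zero_mulVec]
  have ha0 : a ≠ 0 := by
    intro h0
    refine hw0 (funext fun i => ?_)
    obtain ⟨j | j, rfl⟩ := e.surjective i
    · exact congrFun h0 j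
    · exact congrFun hb0 j
  refine hJ mu ?_
  rw [← spectrum_toLin', ← Module.End.hasEigenvalue_iff_mem_spectrum]
  exact Module.End.hasEigenvalue_of_hasEigenvector
    ⟨Module.End.mem_eigenspace_iff.mpr h4, ha0⟩

/-- A left eigenvector for an eigenvalue outside the open left half-plane vanishes. -/
theorem IsFiniteDynamicsStable.left_eq_zero {E A : Matrix ι ι ℝ}
    (h : IsFiniteDynamicsStable E A) {mu : ℂ} (hmu : 0 ≤ mu.re) {y : ι → ℂ}
    (hy : mu • (toC Eᵀ *ᵥ y) = toC Aᵀ *ᵥ y) : y = 0 := by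
  by_contra hy0
  have h1 : (mu • toC E - toC A)ᵀ.det = 0 := by
    refine exists_mulVec_eq_zero_iff.mp ⟨y, hy0, ?_⟩
    rw [transpose_sub, transpose_smul, Matrix.sub_mulVec, smul_mulVec, sub_eq_zero]
    exact hy
  rw [det_transpose] at h1
  obtain ⟨v, hv0, hv⟩ := exists_mulVec_eq_zero_iff.mpr h1
  rw [Matrix.sub_mulVec, smul_mulVec, sub_eq_zero] at hv
  exact absurd (h.re_neg hv hv0) (not_lt.mpr hmu)

theorem HautusStabilizable.of_isFiniteDynamicsStabilizable {κ : Type*} [Fintype κ]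
    {E A : Matrix ι ι ℝ} {B : Matrix ι κ ℝ} (h : IsFiniteDynamicsStabilizable E A B) :
    HautusStabilizable E A B := by
  obtain ⟨K, hK⟩ := h
  intro mu hmu y hy hB
  refine hK.left_eq_zero hmu ?_
  rw [← hy, transpose_sub, toC_sub, Matrix.sub_mulVec, transpose_mul, toC_mul, ← mulVec_mulVec, hB,
    mulVec_zero, sub_zero]

theorem HasStableForm.isImpulseFree {E G : Matrix ι ι ℝ} (h : HasStableForm E G) :
    IsImpulseFree E G := by
  obtain ⟨r, q, W, Wi, T, Ti, J, -, -, t1, t2, hE, hG, -⟩ := h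
  rw [isImpulseFree_iff]
  intro x y hx hy
  have h0 : ∀ z, T *ᵥ (Ti *ᵥ z) = z := fun z => by rw [mulVec_mulVec, t1, one_mulVec]
  have hx' : (fromBlocks 1 0 0 0 : Matrix (Fin r ⊕ Fin q) (Fin r ⊕ Fin q) ℝ) *ᵥ (Ti *ᵥ x) = 0 := by
    rw [← hE, ← mulVec_mulVec, ← mulVec_mulVec, h0, hx, mulVec_zero]
  have hy' : fromBlocks J 0 0 1 *ᵥ (Ti *ᵥ x) +
      (fromBlocks 1 0 0 0 : Matrix (Fin r ⊕ Fin q) (Fin r ⊕ Fin q) ℝ) *ᵥ (Ti *ᵥ y) = 0 := by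
    rw [← hE, ← hG, ← mulVec_mulVec, ← mulVec_mulVec, ← mulVec_mulVec, ← mulVec_mulVec, h0, h0,
      ← mulVec_add, hy, mulVec_zero]
  suffices Ti *ᵥ x = 0 by rw [← h0 x, this, mulVec_zero]
  rw [fromBlocks_mulVec] at hx' hy'
  rw [fromBlocks_mulVec] at hy'
  ext (j | j)
  · simpa using congrFun hx' (Sum.inl j)
  · simpa using congrFun hy' (Sum.inr j)

theorem HasStableForm.isFiniteDynamicsStable {E G : Matrix ι ι ℝ} (h : HasStableForm E G) :
    IsFiniteDynamicsStable E G := by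
  obtain ⟨r, q, W, Wi, T, Ti, J, w1, w2, t1, t2, hE, hG, hJ⟩ := h
  have hcard : Fintype.card (Fin r ⊕ Fin q) = Fintype.card ι := by
    simpa using (toLin'OfInv w1 w2).finrank_eq
  let e : Fin r ⊕ Fin q ≃ ι := Fintype.equivOfCardEq hcard
  have hunit : ∀ {M N : Matrix ι ι ℂ}, M * N = 1 → IsUnit M := fun h =>
    (isUnit_iff_isUnit_det _).mpr (isUnit_det_of_right_inverse h)
  set W' := (toC W).submatrix e.symm id with hW'
  set T' := (toC T).submatrix id e.symm with hT'
  have hWu : IsUnit W' := hunit (N := (toC Wi).submatrix id e.symm) (by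
    rw [hW', ← submatrix_mul _ _ _ _ _ Function.bijective_id, ← toC_mul, w1, toC_one]
    simp)
  have hTu : IsUnit T' := hunit (N := (toC Ti).submatrix e.symm id) (by
    rw [hT', submatrix_mul_equiv, ← toC_mul, t1, toC_one]
    simp)
  have hconj : ∀ M : Matrix ι ι ℝ, W' * toC M * T' = reindex e e (toC (W * M * T)) := fun M => by
    rw [toC_mul, toC_mul]
    ext i j
    simp [hW', hT', Matrix.mul_apply]
  have hE' : W' * toC E * T' = reindex e e (fromBlocks 1 0 0 0) := by
    rw [hconj, hE, toC_fromBlocks, toC_one, toC_zero, toC_zero, toC_zero]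
  have hG' : W' * toC G * T' = reindex e e (fromBlocks (toC J) 0 0 1) := by
    rw [hconj, hG, toC_fromBlocks, toC_one, toC_zero, toC_zero]
  -- The point 0 witnesses regularity: a stable `J` is invertible, hence so is `G`.
  refine ⟨⟨0, ?_⟩, r, q, e, toC J, 0, ⟨IsNilpotent.zero, W', T', hWu, hTu, hE', hG'⟩, hJ⟩
  rw [zero_smul, zero_sub, IsUnit.neg_iff, isUnit_iff_isUnit_det]
  have hJu : IsUnit (toC J) := by
    by_contra hn
    have := hJ 0 ((spectrum.zero_mem_iff ℂ).mpr hn)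
    simp at this
  have h1 : (W' * toC G * T').det ≠ 0 := by
    rw [hG', det_reindex_self, det_fromBlocks_zero₂₁, det_one, mul_one]
    exact ((isUnit_iff_isUnit_det _).mp hJu).ne_zero
  rw [det_mul, det_mul] at h1
  exact (right_ne_zero_of_mul (left_ne_zero_of_mul h1)).isUnit

variable {κ o : Type*} [Fintype κ] [Fintype o]

theorem NoImaginaryEigenvalue.of_ham {E A : Matrix ι ι ℝ} {B : Matrix ι κ ℝ} {C : Matrix o ι ℝ}
    (h : ∀ lam : ℂ, lam.re = 0 → ¬ IsFiniteEigenvalue (hamE E) (hamA A B C) lam) :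
    NoImaginaryEigenvalue E A (B * Bᵀ) (Cᵀ * C) := by
  intro mu hmu x y hx hy
  by_contra hne
  refine h mu hmu ⟨Sum.elim x y, fun h0 => hne ⟨funext fun j => congrFun h0 (Sum.inl j),
    funext fun j => congrFun h0 (Sum.inr j)⟩, ?_⟩
  rw [hamE, hamA, smul_mulVec, toC_fromBlocks, toC_fromBlocks, fromBlocks_mulVec,
    fromBlocks_mulVec]
  simp only [Sum.elim_comp_inl, Sum.elim_comp_inr, toC_zero, toC_neg, zero_mulVec, add_zero,
    zero_add, Matrix.neg_mulVec]
  rw [← sub_eq_add_neg, hx, ← neg_add, hy, neg_neg]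
  ext (j | j) <;> rfl

theorem IsImpulseFree.eq_zero_of_ham {E A : Matrix ι ι ℝ} {B : Matrix ι κ ℝ} {C : Matrix o ι ℝ}
    (h : IsImpulseFree (hamE E) (hamA A B C)) (x y u v : ι → ℝ) (hx : E *ᵥ x = 0)
    (hy : Eᵀ *ᵥ y = 0) (h1 : A *ᵥ x - (B * Bᵀ) *ᵥ y + E *ᵥ u = 0)
    (h2 : (Cᵀ * C) *ᵥ x + Aᵀ *ᵥ y - Eᵀ *ᵥ v = 0) : x = 0 ∧ y = 0 := by
  have key := isImpulseFree_iff.mp h (Sum.elim x y) (Sum.elim u v) (by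
    rw [hamE, fromBlocks_mulVec]
    simp only [Sum.elim_comp_inl, Sum.elim_comp_inr, hx, hy, zero_mulVec, add_zero]
    ext (j | j) <;> rfl) (by
    rw [hamE, hamA, fromBlocks_mulVec, fromBlocks_mulVec]
    simp only [Sum.elim_comp_inl, Sum.elim_comp_inr, zero_mulVec, add_zero, zero_add,
      Matrix.neg_mulVec, ← sub_eq_add_neg, ← Sum.elim_add_add, h1]
    rw [show -((Cᵀ * C) *ᵥ x) - Aᵀ *ᵥ y + Eᵀ *ᵥ v = -((Cᵀ * C) *ᵥ x + Aᵀ *ᵥ y - Eᵀ *ᵥ v) by abel,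
      h2, neg_zero]
    ext (j | j) <;> rfl)
  exact ⟨funext fun j => congrFun key (Sum.inl j), funext fun j => congrFun key (Sum.inr j)⟩

theorem RiccatiSolvable.exists_isStabilizingSolution {E A : Matrix ι ι ℝ} {B : Matrix ι κ ℝ}
    {C : Matrix o ι ℝ} (h : RiccatiSolvable E A B (Cᵀ * C)) :
    ∃ X, IsStabilizingSolution E A B C X := by
  obtain ⟨X, hE, hric, hS⟩ := h
  refine ⟨X, ⟨?_, hE⟩, hS.isFiniteDynamicsStable.1, hS.isImpulseFree, hS.isFiniteDynamicsStable⟩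
  rw [riccati] at hric
  rw [Matrix.mul_assoc Xᵀ]
  exact hric

/-- With `z = y - X x`, the Riccati equation turns the second row into a left eigenvector equation
of the closed loop at `-lam`. So `z = 0`, and `x` is then a closed-loop eigenvector at `lam`; both
points are imaginary. -/
theorem IsStabilizingSolution.not_isFiniteEigenvalue {E A X : Matrix ι ι ℝ} {B : Matrix ι κ ℝ}
    {C : Matrix o ι ℝ} (h : IsStabilizingSolution E A B C X) {lam : ℂ} (hlam : lam.re = 0) :
    ¬ IsFiniteEigenvalue (hamE E) (hamA A B C) lam := by
  obtain ⟨⟨hric, hE⟩, -, -, hst⟩ := h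
  rintro ⟨v, hv0, hv⟩
  rw [hamE, hamA, smul_mulVec, toC_fromBlocks, toC_fromBlocks, fromBlocks_mulVec,
    fromBlocks_mulVec] at hv
  set x := v ∘ Sum.inl with hx
  set y := v ∘ Sum.inr with hy
  simp only [toC_zero, toC_neg, zero_mulVec, add_zero, zero_add, Matrix.neg_mulVec,
    ← sub_eq_add_neg] at hv
  have h1 : lam • (toC E *ᵥ x) = toC A *ᵥ x - toC (B * Bᵀ) *ᵥ y :=
    funext fun j => congrFun hv (Sum.inl j)
  have h2 : lam • (toC Eᵀ *ᵥ y) = -(toC (Cᵀ * C) *ᵥ x) - toC Aᵀ *ᵥ y :=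
    funext fun j => congrFun hv (Sum.inr j)
  set z := y - toC X *ᵥ x with hz
  have hyz : y = z + toC X *ᵥ x := by rw [hz, sub_add_cancel]
  have hEX : toC Eᵀ *ᵥ (toC X *ᵥ x) = toC Xᵀ *ᵥ (toC E *ᵥ x) := by
    rw [mulVec_mulVec, ← toC_mul, hE, toC_mul, ← mulVec_mulVec]
  have hricx := congrArg (fun M => toC M *ᵥ x) hric
  have h1' := congrArg (toC Xᵀ *ᵥ ·) h1
  simp only [toC_add, toC_sub, toC_mul, toC_zero, zero_mulVec, Matrix.sub_mulVec,
    Matrix.add_mulVec, ← mulVec_mulVec, mulVec_sub, mulVec_smul, hyz, mulVec_add, hEX, smul_add]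
    at h1 h2 hricx h1'
  have hz0 : z = 0 := by
    refine hst.left_eq_zero (mu := -lam) (by simp [hlam]) ?_
    simp only [transpose_sub, transpose_mul, transpose_transpose, toC_sub, toC_mul,
      Matrix.sub_mulVec, ← mulVec_mulVec]
    rw [h1'] at h2
    rw [neg_smul, eq_sub_of_add_eq h2, ← sub_eq_zero, ← hricx]
    abel
  have hx0 : x = 0 := by
    by_contra hx0
    rw [hz0] at h1
    refine absurd (hst.re_neg (mu := lam) (v := x) ?_ hx0) (by simp [hlam])
    simp only [toC_sub, toC_mul, Matrix.sub_mulVec, ← mulVec_mulVec]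
    simpa using h1
  refine hv0 (funext fun j => ?_)
  rcases j with j | j
  · exact congrFun hx0 j
  · rw [hz0, hx0, mulVec_zero, add_zero] at hyz
    exact congrFun hyz j

/-- The same triangularization in the kernel criterion: the transposed closed loop gives `z = 0`,
then the closed loop gives `x = 0`. -/
theorem IsStabilizingSolution.isImpulseFree_ham {E A X : Matrix ι ι ℝ} {B : Matrix ι κ ℝ}
    {C : Matrix o ι ℝ} (h : IsStabilizingSolution E A B C X) :
    IsImpulseFree (hamE E) (hamA A B C) := by
  obtain ⟨⟨hric, hE⟩, -, himp, -⟩ := h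
  rw [isImpulseFree_iff]
  intro p w hp hw
  rw [hamE, hamA, fromBlocks_mulVec, fromBlocks_mulVec] at hw
  rw [hamE, fromBlocks_mulVec] at hp
  set x := p ∘ Sum.inl with hx
  set y := p ∘ Sum.inr with hy
  set u := w ∘ Sum.inl
  set v := w ∘ Sum.inr
  simp only [zero_mulVec, add_zero, zero_add, Matrix.neg_mulVec,
    ← sub_eq_add_neg, ← Sum.elim_add_add] at hw hp
  have hEx : E *ᵥ x = 0 := funext fun j => congrFun hp (Sum.inl j)
  have hEy : Eᵀ *ᵥ y = 0 := funext fun j => congrFun hp (Sum.inr j)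
  have h1 : A *ᵥ x - (B * Bᵀ) *ᵥ y + E *ᵥ u = 0 := funext fun j => congrFun hw (Sum.inl j)
  have h2 : -((Cᵀ * C) *ᵥ x) - Aᵀ *ᵥ y + Eᵀ *ᵥ v = 0 := funext fun j => congrFun hw (Sum.inr j)
  set z := y - X *ᵥ x with hz
  have hyz : y = z + X *ᵥ x := by rw [hz, sub_add_cancel]
  have hEX : ∀ a, Eᵀ *ᵥ (X *ᵥ a) = Xᵀ *ᵥ (E *ᵥ a) := fun a => by
    rw [mulVec_mulVec, hE, ← mulVec_mulVec]
  have hricx := congrArg (fun M => M *ᵥ x) hric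
  have h1' := congrArg (Xᵀ *ᵥ ·) h1
  simp only [zero_mulVec, Matrix.sub_mulVec, Matrix.add_mulVec, ← mulVec_mulVec, mulVec_sub, hyz,
    mulVec_add, mulVec_zero] at h1 h2 hricx h1'
  have hz0 : z = 0 := by
    refine isImpulseFree_iff.mp himp.transpose z (X *ᵥ u - v) ?_ ?_
    · rw [hz, mulVec_sub, hEy, hEX, hEx, mulVec_zero, sub_zero]
    · simp only [transpose_sub, transpose_mul, transpose_transpose, Matrix.sub_mulVec,
        ← mulVec_mulVec, mulVec_sub, hEX]
      have h3 := congrArg₂ (· - ·) (congrArg₂ (· + ·) h2 hricx) h1'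
      simp only [add_zero, sub_zero] at h3
      rw [← neg_eq_zero, ← h3]
      abel
  have hx0 : x = 0 := by
    refine isImpulseFree_iff.mp himp x u hEx ?_
    rw [hz0] at h1
    simp only [Matrix.sub_mulVec, ← mulVec_mulVec]
    simpa using h1
  ext (j | j)
  · exact congrFun hx0 j
  · rw [hz0, hx0, mulVec_zero, add_zero] at hyz
    exact congrFun hyz j

end Pencils

end DescriptorLQR

/-! ### The equivalence. -/

theorem mainTheorem9 {n m k : ℕ} (E A : Matrix (Fin n) (Fin n) ℝ)
    (B : Matrix (Fin n) (Fin m) ℝ) (C : Matrix (Fin k) (Fin n) ℝ)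
    (hreg : DescriptorLQR.IsRegular E A) :
    (∃ X : Matrix (Fin n) (Fin n) ℝ, DescriptorLQR.IsStabilizingSolution E A B C X) ↔
      (DescriptorLQR.IsFiniteDynamicsStabilizable E A B ∧
        DescriptorLQR.IsRegular (DescriptorLQR.hamE E) (DescriptorLQR.hamA A B C) ∧
        DescriptorLQR.IsImpulseFree (DescriptorLQR.hamE E) (DescriptorLQR.hamA A B C) ∧
        ∀ lam : ℂ, lam.re = 0 →
          ¬ DescriptorLQR.IsFiniteEigenvalue (DescriptorLQR.hamE E)
              (DescriptorLQR.hamA A B C) lam) := by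
  constructor
  · rintro ⟨X, hX⟩
    refine ⟨⟨B.transpose * X, ?_⟩, ⟨0, ?_⟩, hX.isImpulseFree_ham, fun lam hlam =>
      hX.not_isFiniteEigenvalue hlam⟩
    · rw [← Matrix.mul_assoc]
      exact hX.2.2.2
    -- Singularity at `s = 0` would make 0 an eigenvalue on the imaginary axis.
    · by_contra hu
      rw [Matrix.isUnit_iff_isUnit_det, isUnit_iff_ne_zero, not_not] at hu
      obtain ⟨v, hv0, hv⟩ := Matrix.exists_mulVec_eq_zero_iff.mpr hu
      rw [Matrix.sub_mulVec, sub_eq_zero] at hv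
      exact hX.not_isFiniteEigenvalue Complex.zero_re ⟨v, hv0, hv⟩
  · rintro ⟨hs, -, hi, hn⟩
    exact (DescriptorLQR.riccatiSolvable_of_hautus (.of_isFiniteDynamicsStabilizable hs)
      (.of_ham hn)
      hi.eq_zero_of_ham).exists_isStabilizingSolution
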